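/- Let $G$ be a $\sigma$-compact locally compact Abelian group with Haar measure $\theta_G$, and let $\Lambda \subset G$ be a Delone set (uniformly discrete and relatively dense, where $S$ is relatively dense if $S+K=G$ for some compact $K$). Then the following statements are equivalent. (i) $\Lambda$ is a regular inter model set with metrisable internal group. That is, there are a metrisable locally compact Abelian group $H$, a cut and project scheme $(G\times H,\mathcal L)$ (a discrete cocompact subgroup $\mathcal L\subset G\times H$ on which $\pi_1$ is injective and for which $\pi_2(\mathcal L)$ is dense in $H$), and a relatively compact $W\subset H$ with $W^\circ\neq\varnothing$ and $\theta_H(\partial W)=0$, such that $\curlywedge(W^\circ)\subset\Lambda\subset\curlywedge(\overline W)$. Here $\curlywedge(A)=\{\pi_1(\ell) : \ell\in\mathcal L,\ \pi_2(\ell)\in A\}$. (ii) There exist sequences $(\omega_n)$, $(\nu_n)$ of positive Radon measures on $G$ with $$0\le\omega_1\le\omega_2\le\dots\le\omega_n\le\dots\le\delta_\Lambda\le\dots\le\nu_n\le\dots\le\nu_2\le\nu_1 ,$$ where $\delta_\Lambda=\sum_{x\in\Lambda}\delta_x$, such that: (a) all $\omega_n$ and $\nu_n$ are strongly almost periodic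 (for all $f\in C_c(G)$, the function $f*\omega_n$, respectively $f*\nu_n$, is Bohr almost periodic), and their supports are Meyer sets (a set $S$ is Meyer if it is relatively dense and $S-S-S$ meets every compact set in a finite set); (b) the means $M(\nu_n-\omega_n)$ exist and $\lim_n M(\nu_n-\omega_n)=0$, where $M(\mu)=\lim_{k}\mu(x+A_k)/\theta_G(A_k)$ for every van Hove sequence $(A_k)$ in $G$ and every $x\in G$; a van Hove sequence is a sequence of compact sets $A_k$ of positive Haar measure such that $\theta_G(\partial^K A_k)/\theta_G(A_k)\to0$ for every compact $K\subset G$, where $\partial^K A=((A+K)\setminus A^\circ)\cup((\overline{G\setminus A}-K)\cap A)$; (c) for all $n$, $\nu_n\preccurlyeq\omega_1$ and $\omega_n\preccurlyeq\omega_1$. Here $\omega\preccurlyeq\nu$ means that for each $\varepsilon>0$ there is an $\varepsilon'>0$ with $P^\infty_{\varepsilon'}(\nu)\subset P^\infty_{\varepsilon}(\omega)$, where $P^\infty_\varepsilon(\omega)=\{t\in G:\sup_{x\in G}|\omega(\{t+x\})-\omega(\{x\})|<\varepsilon\}$. -/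

import Mathlib

open MeasureTheory Filter Topology
open scoped Pointwise ENNReal

universe u

namespace MeyerComb

section Sets

variable {G : Type*} [AddCommGroup G] [TopologicalSpace G]

/-- `S` is relatively dense: `S + K = G` for some compact `K`. -/
def RelativelyDense (S : Set G) : Prop :=
  ∃ K : Set G, IsCompact K ∧ S + K = Set.univ

/-- `S` is uniformly discrete: some neighbourhood `U` of `0` contains no difference of two
distinct points of `S`. -/
def UniformlyDiscrete (S : Set G) : Prop :=
  ∃ U ∈ 𝓝 (0 : G), ∀ x ∈ S, ∀ y ∈ S, x - y ∈ U → x = y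

/-- A Delone set: uniformly discrete and relatively dense. -/
def IsDelone (S : Set G) : Prop :=
  UniformlyDiscrete S ∧ RelativelyDense S

/-- `S` is locally finite: it meets every compact set in a finite set. -/
def LocFinite (S : Set G) : Prop :=
  ∀ K : Set G, IsCompact K → (S ∩ K).Finite

/-- A Meyer set: relatively dense, with `S - S - S` locally finite. -/
def IsMeyer (S : Set G) : Prop :=
  RelativelyDense S ∧ LocFinite (S - S - S)

/-- A lattice: a discrete and relatively dense (that is, cocompact) subgroup. -/
def IsLattice (L : AddSubgroup G) : Prop :=
  DiscreteTopology L ∧ RelativelyDense (L : Set G)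

end Sets

section CutAndProject

/-- A cut and project scheme `(G × H, L)`: a lattice `L` in `G × H` such that the first projection
is injective on `L` and the second projection of `L` is dense in `H`. -/
structure CutProjectScheme (G H : Type*) [AddCommGroup G] [TopologicalSpace G]
    [AddCommGroup H] [TopologicalSpace H] where
  /-- the lattice of the scheme -/
  lattice : AddSubgroup (G × H)
  isLattice : IsLattice lattice
  injOn_fst : Set.InjOn Prod.fst (lattice : Set (G × H))
  dense_snd : Dense (Prod.snd '' (lattice : Set (G × H)))

variable {G H : Type*} [AddCommGroup G] [TopologicalSpace G]
  [AddCommGroup H] [TopologicalSpace H]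

/-- The projection set `⋏(A)`, the set of all `x` in the first projection of the lattice
with `x⋆ ∈ A`. -/
def CutProjectScheme.oplam (C : CutProjectScheme G H) (A : Set H) : Set G :=
  {x | ∃ y ∈ A, (x, y) ∈ C.lattice}

end CutAndProject

/-- `Λ` is a regular inter model set with metrisable internal group: there are a cut and project
scheme `(G × H, L)` with `H` a metrisable locally compact Abelian group and a relatively compact
window `W ⊆ H` with non-empty interior and boundary of Haar measure zero such that
`⋏(interior W) ⊆ Λ ⊆ ⋏(closure W)`. -/
def IsRegularInterModelSetMetrisable {G : Type u} [AddCommGroup G] [TopologicalSpace G]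
    (Λ : Set G) : Prop :=
  ∃ (H : Type u) (_ : AddCommGroup H) (_ : TopologicalSpace H) (_ : IsTopologicalAddGroup H)
    (_ : LocallyCompactSpace H) (_ : TopologicalSpace.MetrizableSpace H)
    (_ : MeasurableSpace H) (_ : BorelSpace H)
    (C : CutProjectScheme G H) (W : Set H),
    IsCompact (closure W) ∧ (interior W).Nonempty ∧
      (Measure.addHaar : Measure H) (frontier W) = 0 ∧
      C.oplam (interior W) ⊆ Λ ∧ Λ ⊆ C.oplam (closure W)

section Measures

variable {G : Type*} [AddCommGroup G] [TopologicalSpace G]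

/-- Bohr almost periodicity of a complex function on `G`: it is continuous, and for every `ε > 0`
its `ε`-almost periods are relatively dense. -/
def IsAlmostPeriodic (F : G → ℂ) : Prop :=
  Continuous F ∧ ∀ ε : ℝ, 0 < ε → RelativelyDense {t : G | ∀ x : G, ‖F (x + t) - F x‖ < ε}

/-- The `K`-boundary `((A + K) \ A°) ∪ ((closure (G \ A) - K) ∩ A)` of `A`. -/
def vanHoveBoundary (K A : Set G) : Set G :=
  ((A + K) \ interior A) ∪ ((closure Aᶜ - K) ∩ A)

variable [MeasurableSpace G]

/-- A van Hove sequence with respect to the Haar measure `θ`. -/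
def IsVanHove (θ : Measure G) (A : ℕ → Set G) : Prop :=
  (∀ n, IsCompact (A n)) ∧ (∀ n, 0 < θ (A n)) ∧
    ∀ K : Set G, IsCompact K →
      Tendsto (fun n => θ (vanHoveBoundary K (A n)) / θ (A n)) atTop (𝓝 0)

/-- The difference `ν - ω` of the measures `ν` and `ω` has mean `m`: along each van Hove sequence
`A`, the quotients `(ν - ω)(x + A n) / θ (A n)` converge to `m`, for all `x`. -/
def HasMeanSub (θ ν ω : Measure G) (m : ℝ) : Prop :=
  ∀ A : ℕ → Set G, IsVanHove θ A → ∀ x : G,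
    Tendsto (fun n => (ν.real (x +ᵥ A n) - ω.real (x +ᵥ A n)) / θ.real (A n)) atTop (𝓝 m)

/-- The measure `ω` is strongly almost periodic: `f * ω` is almost periodic for every continuous
compactly supported `f`. -/
def IsStronglyAlmostPeriodic (ω : Measure G) : Prop :=
  ∀ f : G → ℂ, Continuous f → HasCompactSupport f →
    IsAlmostPeriodic (fun x => ∫ y, f (x - y) ∂ω)

/-- The set of `ε`-sup-almost periods of `ω`, that is, of all `t` with
`sup_x |ω {t + x} - ω {x}| < ε`. -/
def supAlmostPeriods (ω : Measure G) (ε : ℝ) : Set G :=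
  {t | ⨆ x : G, ENNReal.ofReal |ω.real {t + x} - ω.real {x}| < ENNReal.ofReal ε}

/-- `ω ≼ ν`: the function `x ↦ ω {x}` is uniformly continuous in the uniformity that the sets of
sup-almost periods of `ν` define. -/
def UniformlyContinuousIn (ω ν : Measure G) : Prop :=
  ∀ ε : ℝ, 0 < ε → ∃ ε' : ℝ, 0 < ε' ∧ supAlmostPeriods ν ε' ⊆ supAlmostPeriods ω ε

/-- The Dirac comb `δ_Λ`, the sum of the unit point masses at the points of `Λ`. -/
noncomputable def diracComb (Λ : Set G) : Measure G :=
  Measure.sum fun x : Λ => Measure.dirac (x : G)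

end Measures

end MeyerComb

namespace MeyerComb

/-! ### Locally finite, relatively dense and Meyer sets. -/

section LocFinite

variable {G : Type*} [AddCommGroup G] [TopologicalSpace G]

/-! Both directions translate between measures on `G` and continuous weights `φ` on an internal
group `H`: the comb of `φ` gives a point `x` of the projected lattice the mass `φ(x⋆)`, and its
averages are governed by the compact torus `(G × H) ⧸ L`.

From a window to combs, take continuous weights increasing to the indicator of the interior of `W`
and others decreasing to that of its closure. Convolving a comb with a test function gives a
continuous function on the torus, read along the dense orbit of `G`; hence strong almost periodicity
(`isStronglyAlmostPeriodic_modelComb`). Unique ergodicity of that orbit makes the mean of a comb a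
fixed multiple of the Haar integral of its weight (`exists_density`), so the means of the
differences tend to a multiple of the measure of the frontier, which is zero. The first lower weight
has a peak so sharp that its almost periods `t` must have `t⋆` near `0`, and this is what the
relation `≼` needs (`uniformlyContinuousIn_modelComb`).

From combs to a window, `H` has to be built. The sup distance of the point masses of `ω 0` from
their translates is a seminorm on `G`, and `H` is the completion; the lattice is the graph of `G →
H`. Balls are relatively dense by almost periodicity and the Meyer property
(`relativelyDense_almostPeriods`), and small balls are locally finite because they lie in the
difference set of the support. This yields local compactness of `H` and the lattice property
(`isLattice_range_starMap`). The relation `≼` says that all point masses extend to continuous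
functions `ψ n ≤ φ k` on `H`. With `U` the union of the sets `ψ n > 0` and `K` the intersection of
the sets `φ n ≥ 1`, the indicator of `K \ U` is at most `φ n - ψ n`, so `exists_density` and the
vanishing means make `K \ U` null. A window lies between `U` and `K`. -/

theorem LocFinite.mono {X : Type*} [TopologicalSpace X] {S T : Set X}
    (hT : LocFinite T) (h : S ⊆ T) : LocFinite S :=
  fun K hK => (hT K hK).subset (Set.inter_subset_inter_left _ h)

theorem LocFinite.isClosed {X : Type*} [TopologicalSpace X] [T2Space X]
    [LocallyCompactSpace X] {S : Set X} (hS : LocFinite S) :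
    IsClosed S := by
  rw [← isOpen_compl_iff, isOpen_iff_mem_nhds]
  intro x hx
  obtain ⟨K, hK, hxK⟩ := exists_compact_mem_nhds x
  have h : (S ∩ K)ᶜ ∈ 𝓝 x :=
    (hS K hK).isClosed.isOpen_compl.mem_nhds fun h => hx h.1
  filter_upwards [h, hxK] with y hy hyK hyS using hy ⟨hyS, hyK⟩

/-- A locally finite set is isolated from each point, except for the point itself. -/
theorem LocFinite.eventually_eq {X : Type*} [TopologicalSpace X] [T2Space X]
    [LocallyCompactSpace X] {S : Set X} (hS : LocFinite S) (x : X) : ∀ᶠ y in 𝓝 x, y ∈ S → y = x := by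
  have h : (S \ {x})ᶜ ∈ 𝓝 x :=
    (hS.mono Set.sdiff_subset).isClosed.isOpen_compl.mem_nhds fun h => h.2 rfl
  filter_upwards [h] with y hy hyS
  by_contra hne
  exact hy ⟨hyS, hne⟩

theorem LocFinite.vadd [IsTopologicalAddGroup G] {S : Set G} (hS : LocFinite S) (a : G) :
    LocFinite (a +ᵥ S) := by
  intro K hK
  have h := (hS (-a +ᵥ K) (hK.vadd (-a))).image (a + ·)
  refine h.subset ?_
  rintro _ ⟨⟨s, hs, rfl⟩, hsK⟩
  exact ⟨s, ⟨hs, Set.mem_neg_vadd_set_iff.2 hsK⟩, rfl⟩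

theorem LocFinite.neg [IsTopologicalAddGroup G] {S : Set G} (hS : LocFinite S) :
    LocFinite (-S) := by
  intro K hK
  have h := (hS (-K) hK.neg).image (fun x => -x)
  refine h.subset ?_
  rintro x ⟨hx, hxK⟩
  exact ⟨-x, ⟨hx, by simpa using hxK⟩, by simp⟩

theorem LocFinite.add_finite [IsTopologicalAddGroup G] {S F : Set G} (hS : LocFinite S)
    (hF : F.Finite) : LocFinite (S + F) := by
  intro K hK
  refine (hF.biUnion (t := fun a => (a +ᵥ S) ∩ K) fun a _ => hS.vadd a K hK).subset ?_
  rintro _ ⟨⟨s, hs, a, ha, rfl⟩, hk⟩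
  exact Set.mem_biUnion ha ⟨⟨s, hs, add_comm _ _⟩, hk⟩

theorem RelativelyDense.nonempty {S : Set G} (hS : RelativelyDense S) : S.Nonempty := by
  obtain ⟨K, -, h⟩ := hS
  obtain ⟨s, hs, -⟩ : (0 : G) ∈ S + K := h ▸ Set.mem_univ _
  exact ⟨s, hs⟩

theorem RelativelyDense.mono {S T : Set G} (hS : RelativelyDense S) (h : S ⊆ T) :
    RelativelyDense T := by
  obtain ⟨K, hK, e⟩ := hS
  exact ⟨K, hK, Set.eq_univ_of_univ_subset (e ▸ Set.add_subset_add_right h)⟩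

/-- A relatively dense set whose differences with the set `T` are locally finite has finitely
many translates that cover `T`. -/
theorem exists_finite_subset_add {S T : Set G} (hS : RelativelyDense S)
    (h : LocFinite (T - S)) : ∃ F : Set G, F.Finite ∧ F ⊆ T - S ∧ T ⊆ S + F := by
  obtain ⟨K, hK, e⟩ := hS
  refine ⟨_, h K hK, Set.inter_subset_left, fun t ht => ?_⟩
  obtain ⟨s, hs, k, hk, rfl⟩ : t ∈ S + K := e ▸ Set.mem_univ t
  exact ⟨s, hs, k, ⟨⟨s + k, ht, s, hs, by simp⟩, hk⟩, rfl⟩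

/-- Relative density covers `S - S` by finitely many translates of `S`, which trades one of the four
terms for a finite set. The fourfold differences are the ones that `relativelyDense_almostPeriods`
must isolate from `0`. -/
theorem IsMeyer.locFinite_sub_sub_sub [IsTopologicalAddGroup G] {S : Set G} (hS : IsMeyer S) :
    LocFinite ((S - S) - (S - S)) := by
  have h0 : LocFinite (S - S - S) := hS.2
  obtain ⟨F, hF, -, hSF⟩ := exists_finite_subset_add hS.1 h0
  refine (h0.neg.add_finite hF).mono ?_
  rintro _ ⟨p, hp, q, hq, rfl⟩
  obtain ⟨s, hs, f, hf, rfl⟩ := hSF hp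
  obtain ⟨a, ha, b, hb, rfl⟩ := hq
  refine ⟨s - (a - b), ?_, f, hf, by simp only; abel⟩
  rw [Set.mem_neg]
  exact ⟨a - b, ⟨a, ha, b, hb, rfl⟩, s, hs, by simp⟩

theorem IsMeyer.locFinite_sub [IsTopologicalAddGroup G] {S : Set G} (hS : IsMeyer S) :
    LocFinite (S - S) := by
  refine hS.locFinite_sub_sub_sub.mono ?_
  rintro x hx
  obtain ⟨a, ha⟩ := hS.1.nonempty
  exact ⟨x, hx, 0, ⟨a, ha, a, ha, by simp⟩, by simp⟩

theorem IsMeyer.locFinite [IsTopologicalAddGroup G] {S : Set G} (hS : IsMeyer S) :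
    LocFinite S := by
  obtain ⟨a, ha⟩ := hS.1.nonempty
  refine (hS.locFinite_sub.vadd a).mono fun x hx => ⟨x - a, ⟨x, hx, a, ha, rfl⟩, by simp⟩

end LocFinite

/-! ### Existence of van Hove sequences, by polynomial growth of iterated sums. -/

section VanHove

variable {G : Type*} [AddCommGroup G] [TopologicalSpace G]

/-- The `n`-fold sum of a set with itself. -/
def iterSum {A : Type*} [AddCommGroup A] (K : Set A) : ℕ → Set A
  | 0 => {0}
  | n + 1 => iterSum K n + K

theorem isCompact_iterSum [IsTopologicalAddGroup G] {K : Set G} (hK : IsCompact K) (n : ℕ) :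
    IsCompact (iterSum K n) := by
  induction n with
  | zero => exact isCompact_singleton
  | succ n ih => exact ih.add hK

theorem monotone_iterSum {A : Type*} [AddCommGroup A] {K : Set A} (hK : (0 : A) ∈ K) :
    Monotone (iterSum K) :=
  monotone_nat_of_le_succ fun _ x hx => ⟨x, hx, 0, hK, add_zero x⟩

theorem iterSum_subset_interior [IsTopologicalAddGroup G] {K : Set G} (hK : K ∈ 𝓝 (0 : G))
    (n : ℕ) : iterSum K n ⊆ interior (iterSum K (n + 1)) := by
  intro x hx
  refine interior_mono (Set.add_subset_add_left interior_subset)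
    ((isOpen_interior.add_left (s := iterSum K n)).interior_eq.symm ▸ ?_ :
      x ∈ interior (iterSum K n + interior K))
  exact ⟨x, hx, 0, mem_interior_iff_mem_nhds.2 hK, add_zero x⟩

/-- The iterated sums of a compact neighbourhood are covered by polynomially many translates. -/
theorem exists_iterSum_subset [IsTopologicalAddGroup G] {K : Set G} (hc : IsCompact K)
    (hK : K ∈ 𝓝 (0 : G)) : ∃ d : ℕ, ∀ n : ℕ, ∃ F : Finset G, F.card ≤ (n + 1) ^ d ∧
      iterSum K (n + 1) ⊆ K + (F : Set G) := by
  classical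
  -- Each further summand `K` costs one translation by an element of `F`. As the group is Abelian,
  -- only the multiplicities of these elements matter, and they are at most `n`; hence the exponent
  -- `F.card`.
  obtain ⟨F, hF⟩ : ∃ F : Finset G, K + K ⊆ K + (F : Set G) := by
    obtain ⟨F, -, hF⟩ := (hc.add hc).elim_nhds_subcover (fun x => x +ᵥ K) fun x _ => by
      simpa using vadd_mem_nhds_vadd x hK
    refine ⟨F, fun y hy => ?_⟩
    obtain ⟨x, hx, k, hk, rfl⟩ : ∃ x ∈ F, y ∈ x +ᵥ K := by simpa using hF hy
    exact ⟨k, hk, x, hx, add_comm _ _⟩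
  refine ⟨F.card, fun n => ⟨(Fintype.piFinset fun _ : F => Finset.range (n + 1)).image
    fun m => ∑ f : F, m f • (f : G), ?_, ?_⟩⟩
  · refine Finset.card_image_le.trans ?_
    simp [Fintype.card_piFinset]
  · induction n with
    | zero =>
      rintro _ ⟨_, rfl, k, hk, rfl⟩
      refine ⟨k, hk, 0, ?_, by simp⟩
      simp only [Finset.coe_image, Set.mem_image, Finset.mem_coe, Fintype.mem_piFinset]
      exact ⟨0, by simp, by simp⟩
    | succ n ih =>
      rintro _ ⟨y, hy, k, hk, rfl⟩
      obtain ⟨k', hk', s, hs, rfl⟩ := ih hy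
      obtain ⟨k'', hk'', f, hf, e⟩ := hF ⟨k', hk', k, hk, rfl⟩
      simp only [Finset.coe_image, Set.mem_image, Finset.mem_coe, Fintype.mem_piFinset,
        Finset.mem_range] at hs
      obtain ⟨m, hm, rfl⟩ := hs
      refine ⟨k'', hk'', f + ∑ f : F, m f • (f : G), ?_, ?_⟩
      · simp only [Finset.coe_image, Set.mem_image, Finset.mem_coe, Fintype.mem_piFinset,
          Finset.mem_range]
        refine ⟨m + Pi.single ⟨f, hf⟩ 1, fun a => ?_, ?_⟩
        · have := hm a
          by_cases h : a = ⟨f, hf⟩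
          · subst h; simp; omega
          · simp [h]; omega
        · simp [add_smul, Finset.sum_add_distrib, Pi.single_apply, ite_smul, add_comm]
      · simp only at e ⊢
        rw [← add_assoc, e]; abel

/-- A sequence of polynomial growth does not grow exponentially. -/
theorem exists_lt_add_mul_of_polynomial_growth {v : ℕ → ℝ} (hv : Monotone v) (h1 : 0 < v 1)
    {C : ℝ} {d : ℕ} (hd : ∀ n, v (n + 1) ≤ C * (n + 1) ^ d) {ε : ℝ} (hε : 0 < ε) :
    ∃ n, 1 ≤ n ∧ v (n + 4) < v n + ε * v (n + 2) := by
  -- Otherwise every step of length four multiplies `v` by at least `1 + ε`, which is exponential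
  -- growth.
  by_contra! H
  have hpos : ∀ n, 1 ≤ n → 0 < v n := fun n hn => h1.trans_le (hv hn)
  have hexp : ∀ k : ℕ, (1 + ε) ^ k * v 1 ≤ v (4 * k + 1) := by
    intro k
    induction k with
    | zero => simp
    | succ k ih =>
      have a := H (4 * k + 1) (by omega)
      have b := hv (show 4 * k + 1 ≤ 4 * k + 1 + 2 by omega)
      calc (1 + ε) ^ (k + 1) * v 1 = (1 + ε) * ((1 + ε) ^ k * v 1) := by ring
        _ ≤ (1 + ε) * v (4 * k + 1) := by gcongr
        _ ≤ v (4 * k + 1) + ε * v (4 * k + 1 + 2) := by nlinarith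
        _ ≤ _ := a
  have hC : 0 < C := by
    have := hd 0
    simp at this
    linarith
  have hlim := (tendsto_pow_const_div_const_pow_of_one_lt d (show 1 < 1 + ε by linarith))
  have hsmall : ∀ᶠ k : ℕ in atTop, (k : ℝ) ^ d / (1 + ε) ^ k < v 1 / (C * 5 ^ d) :=
    hlim.eventually_lt_const (by positivity)
  obtain ⟨k, hk, hk1⟩ := (hsmall.and (eventually_ge_atTop 1)).exists
  have h2 := (hexp k).trans (hd (4 * k))
  rw [div_lt_div_iff₀ (by positivity) (by positivity)] at hk
  have hk1' : (1 : ℝ) ≤ k := by exact_mod_cast hk1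
  have h3 : ((4 * k : ℕ) + 1 : ℝ) ^ d ≤ (5 * k) ^ d := by
    gcongr
    push_cast
    linarith
  have h4 : C * ((4 * k : ℕ) + 1 : ℝ) ^ d ≤ C * (5 * k) ^ d := by gcongr
  rw [mul_pow] at h4
  nlinarith

/-- The interior of the `(n + 2)`-fold sum contains the `(n + 1)`-fold sum. A point of the `n`-fold
sum is therefore interior, and it stays interior after adding an element of `K`. -/
theorem vanHoveBoundary_iterSum_subset [IsTopologicalAddGroup G] {K K' : Set G}
    (hK : K ∈ 𝓝 (0 : G)) (hK' : K' ⊆ K) (n : ℕ) :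
    vanHoveBoundary K' (iterSum K (n + 2)) ⊆ iterSum K (n + 4) \ iterSum K n := by
  have h0 : (0 : G) ∈ K := mem_of_mem_nhds hK
  have hmono := monotone_iterSum h0
  have hint := iterSum_subset_interior hK (n + 1)
  rintro x (⟨⟨a, ha, k, hk, rfl⟩, hx⟩ | ⟨⟨a, ha, k, hk, rfl⟩, hx⟩)
  · refine ⟨hmono (show n + 3 ≤ n + 4 by omega) ⟨a, ha, k, hK' hk, rfl⟩, fun h => hx (hint ?_)⟩
    exact hmono (Nat.le_succ n) h
  · refine ⟨hmono (show n + 2 ≤ n + 4 by omega) hx, fun h => ?_⟩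
    rw [closure_compl] at ha
    exact ha (hint ⟨_, h, k, hK' hk, by simp⟩)

variable [MeasurableSpace G] [BorelSpace G]

/-- The `j`-th set is an iterated sum of `E j ∪ K₀`, stopped where slow growth leaves the
surrounding shell less than `1 / (j + 1)` of its measure. Every compact `K` lies in `E j` from some
`j` on, and its boundary then lies in that shell. -/
theorem exists_isVanHove [IsTopologicalAddGroup G] [T2Space G] [LocallyCompactSpace G]
    [SigmaCompactSpace G] (θ : Measure G) [θ.IsAddHaarMeasure] :
    ∃ A : ℕ → Set G, IsVanHove θ A := by
  obtain ⟨K₀, hK₀, hK₀n⟩ := exists_compact_mem_nhds (0 : G)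
  let E := CompactExhaustion.choice G
  have key : ∀ j : ℕ, ∃ n : ℕ, 1 ≤ n ∧ θ.real (iterSum (E j ∪ K₀) (n + 4)) <
      θ.real (iterSum (E j ∪ K₀) n) + 1 / (j + 1) * θ.real (iterSum (E j ∪ K₀) (n + 2)) := by
    intro j
    have hc : IsCompact (E j ∪ K₀) := (E.isCompact j).union hK₀
    have hn : E j ∪ K₀ ∈ 𝓝 (0 : G) := mem_of_superset hK₀n Set.subset_union_right
    obtain ⟨d, hd⟩ := exists_iterSum_subset hc hn
    refine exists_lt_add_mul_of_polynomial_growth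
      (v := fun n => θ.real (iterSum (E j ∪ K₀) n)) (C := θ.real (E j ∪ K₀)) (d := d)
      (fun a b hab => ?_) ?_ (fun n => ?_) (by positivity)
    · exact measureReal_mono (monotone_iterSum (mem_of_mem_nhds hn) hab)
        (isCompact_iterSum hc b).measure_lt_top.ne
    · refine ENNReal.toReal_pos ?_ (isCompact_iterSum hc 1).measure_lt_top.ne
      simpa [iterSum] using (Measure.measure_pos_of_mem_nhds θ hn).ne'
    · obtain ⟨F, hF, hsub⟩ := hd n
      have hU : E j ∪ K₀ + (F : Set G) = ⋃ a ∈ F, a +ᵥ (E j ∪ K₀) := by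
        ext x
        simp only [Set.mem_add, Set.mem_iUnion, Set.mem_vadd_set, vadd_eq_add, Finset.mem_coe]
        constructor
        · rintro ⟨k, hk, a, ha, rfl⟩
          exact ⟨a, ha, k, hk, add_comm _ _⟩
        · rintro ⟨a, ha, k, hk, rfl⟩
          exact ⟨k, hk, a, ha, add_comm _ _⟩
      calc θ.real (iterSum (E j ∪ K₀) (n + 1)) ≤ θ.real (⋃ a ∈ F, a +ᵥ (E j ∪ K₀)) := by
            rw [← hU]
            exact measureReal_mono hsub (hc.add F.finite_toSet.isCompact).measure_lt_top.ne
        _ ≤ ∑ a ∈ F, θ.real (a +ᵥ (E j ∪ K₀)) := measureReal_biUnion_finset_le _ _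
        _ = F.card * θ.real (E j ∪ K₀) := by simp [measureReal_def, measure_vadd]
        _ ≤ (n + 1) ^ d * θ.real (E j ∪ K₀) := by
            gcongr
            exact_mod_cast hF
        _ = _ := mul_comm _ _
  choose n hn1 hn using key
  have hc : ∀ j, IsCompact (E j ∪ K₀) := fun j => (E.isCompact j).union hK₀
  have hnb : ∀ j, E j ∪ K₀ ∈ 𝓝 (0 : G) := fun j =>
    mem_of_superset hK₀n Set.subset_union_right
  have hpos : ∀ j, 0 < θ (iterSum (E j ∪ K₀) (n j + 2)) := fun j => by
    refine (Measure.measure_pos_of_mem_nhds θ (hnb j)).trans_le (measure_mono ?_)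
    have : iterSum (E j ∪ K₀) 1 = E j ∪ K₀ := by simp [iterSum]
    conv_lhs => rw [← this]
    exact monotone_iterSum (mem_of_mem_nhds (hnb j)) (show 1 ≤ n j + 2 by omega)
  refine ⟨fun j => iterSum (E j ∪ K₀) (n j + 2), fun j => isCompact_iterSum (hc j) _, hpos,
    fun K hK => ?_⟩
  obtain ⟨i, hi⟩ := E.exists_superset_of_isCompact hK
  have hlim : Tendsto (fun j : ℕ => ENNReal.ofReal (1 / (j + 1 : ℝ))) atTop (𝓝 0) := by
    simpa using ENNReal.tendsto_ofReal tendsto_one_div_add_atTop_nhds_zero_nat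
  refine tendsto_of_tendsto_of_tendsto_of_le_of_le' tendsto_const_nhds hlim
    (Eventually.of_forall fun _ => zero_le) ?_
  filter_upwards [eventually_ge_atTop i] with j hj
  have hfin : ∀ m, θ (iterSum (E j ∪ K₀) m) ≠ ∞ := fun m =>
    (isCompact_iterSum (hc j) m).measure_lt_top.ne
  refine ENNReal.div_le_of_le_mul ?_
  calc θ (vanHoveBoundary K (iterSum (E j ∪ K₀) (n j + 2)))
      ≤ θ (iterSum (E j ∪ K₀) (n j + 4) \ iterSum (E j ∪ K₀) (n j)) :=
        measure_mono (vanHoveBoundary_iterSum_subset (hnb j)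
          ((hi.trans (E.subset hj)).trans Set.subset_union_left) _)
    _ = ENNReal.ofReal (θ.real (iterSum (E j ∪ K₀) (n j + 4)) -
          θ.real (iterSum (E j ∪ K₀) (n j))) := by
        rw [← measureReal_sdiff (monotone_iterSum (mem_of_mem_nhds (hnb j)) (by omega))
          (isCompact_iterSum (hc j) _).isClosed.measurableSet (hfin _),
          ofReal_measureReal (ne_top_of_le_ne_top (hfin (n j + 4))
            (measure_mono Set.sdiff_subset))]
    _ ≤ ENNReal.ofReal (1 / (j + 1) * θ.real (iterSum (E j ∪ K₀) (n j + 2))) :=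
        ENNReal.ofReal_le_ofReal (by linarith [hn j])
    _ = _ := by rw [ENNReal.ofReal_mul (by positivity), ofReal_measureReal (hfin _)]

end VanHove

/-! ### Point masses of measures carried by locally finite sets. -/

section PurePoint

variable {G : Type*} [TopologicalSpace G] [MeasurableSpace G]

theorem measure_compl_support_eq_zero (μ : Measure G) [μ.Regular] : μ μ.supportᶜ = 0 :=
  Measure.measure_compl_support_of_innerRegularWRT_isCompact_isOpen Measure.Regular.innerRegular

/-- A point of a locally finite support carries a positive mass. -/
theorem measureReal_singleton_pos [BorelSpace G] [T2Space G] [LocallyCompactSpace G]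
    {μ : Measure G} [μ.Regular] (h : LocFinite μ.support) {x : G} (hx : x ∈ μ.support) : 0 < μ.real {x} := by
  have hpos := (Measure.mem_support_iff_forall x).1 hx _ (h.eventually_eq x)
  refine ENNReal.toReal_pos (fun h0 => ?_) isCompact_singleton.measure_lt_top.ne
  refine hpos.ne' (measure_mono_null (t := {x} ∪ μ.supportᶜ) (fun y hy => ?_)
    (measure_union_null h0 (measure_compl_support_eq_zero μ)))
  by_cases hyS : y ∈ μ.support
  · exact Or.inl (hy hyS)
  · exact Or.inr hyS

theorem mem_support_of_measureReal_singleton_ne_zero {μ : Measure G} {x : G}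
    (hx : μ.real {x} ≠ 0) : x ∈ μ.support := by
  rw [Measure.mem_support_iff_forall]
  intro U hU
  refine lt_of_lt_of_le (pos_iff_ne_zero.2 fun h0 => hx ?_)
    (measure_mono (Set.singleton_subset_iff.2 (mem_of_mem_nhds hU)))
  simp [measureReal_def, h0]

/-- The mass of a set for a measure that is carried by a set with finite trace on it. -/
theorem measureReal_eq_sum [BorelSpace G] [T2Space G] {μ : Measure G}
    [IsFiniteMeasureOnCompacts μ] {S : Set G} (h0 : μ Sᶜ = 0) {B : Set G} (F : Finset G) (hF : (F : Set G) ⊆ B)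
    (hB : ∀ x ∈ B, x ∈ S → x ∉ F → μ.real {x} = 0) (hfin : (S ∩ B).Finite) :
    μ.real B = ∑ x ∈ F, μ.real {x} := by
  classical
  have hsum : μ.real F = ∑ x ∈ F, μ.real {x} := by
    rw [← measureReal_biUnion_finset (f := fun x : G => {x})
      (fun a _ b _ hab => Set.disjoint_singleton.2 hab)
      (fun _ _ => measurableSet_singleton _) fun _ _ => isCompact_singleton.measure_lt_top.ne]
    exact congrArg μ.real (by ext; simp)
  rw [← hsum]
  have hnull : μ (B \ F) = 0 := by
    refine measure_mono_null (t := Sᶜ ∪ ⋃ x ∈ (S ∩ B) \ F, {x}) (fun y hy => ?_)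
      (measure_union_null h0 ((measure_biUnion_null_iff
        (hfin.subset Set.sdiff_subset).countable).2 fun x hx => ?_))
    · by_cases hyS : y ∈ S
      · exact Or.inr (by simpa using ⟨⟨hyS, hy.1⟩, hy.2⟩)
      · exact Or.inl hyS
    · have := hB x hx.1.2 hx.1.1 hx.2
      rwa [measureReal_eq_zero_iff isCompact_singleton.measure_lt_top.ne] at this
  refine congrArg ENNReal.toReal (le_antisymm ?_ (measure_mono hF))
  calc μ B ≤ μ (F ∪ (B \ F)) := measure_mono (fun y hy => by
        by_cases h : y ∈ (F : Set G)
        · exact Or.inl h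
        · exact Or.inr ⟨hy, h⟩)
    _ ≤ μ F + μ (B \ F) := measure_union_le _ _
    _ = μ F := by rw [hnull, add_zero]

end PurePoint

/-! ### Averages along van Hove sequences and unique ergodicity. -/

section Averages

/-- A compactly supported continuous function on an Abelian topological group is uniformly
continuous. -/
theorem eventually_forall_norm_sub_lt {G E : Type*} [AddCommGroup G] [TopologicalSpace G]
    [IsTopologicalAddGroup G] [SeminormedAddCommGroup E] {f : G → E} (hf : Continuous f)
    (hc : HasCompactSupport f) {ε : ℝ} (hε : 0 < ε) :
    ∀ᶠ v in 𝓝 (0 : G), ∀ x, ‖f (x + v) - f x‖ < ε := by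
  let _ : UniformSpace G := IsTopologicalAddGroup.rightUniformSpace G
  have _ : IsUniformAddGroup G := isUniformAddGroup_of_addCommGroup
  have h := hc.uniformContinuous_of_continuous hf (Metric.dist_mem_uniformity hε)
  rw [Filter.mem_map, uniformity_eq_comap_nhds_zero G, Filter.mem_comap] at h
  obtain ⟨V, hV, hsub⟩ := h
  filter_upwards [hV] with v hv x
  have : (x, x + v) ∈ (fun p : G × G => (f p.1, f p.2)) ⁻¹' {p | dist p.1 p.2 < ε} :=
    hsub (by simpa using hv)
  simpa [dist_eq_norm, norm_sub_rev] using this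

variable {G : Type*} [AddCommGroup G] [TopologicalSpace G] [IsTopologicalAddGroup G]

theorem vanHoveBoundary_vadd (K A : Set G) (x : G) :
    vanHoveBoundary K (x +ᵥ A) = x +ᵥ vanHoveBoundary K A := by
  have h1 : (x +ᵥ A) + K = x +ᵥ (A + K) := vadd_assoc x A K
  have h2 : interior (x +ᵥ A) = x +ᵥ interior A := interior_vadd x A
  have h3 : closure (x +ᵥ A)ᶜ - K = x +ᵥ (closure Aᶜ - K) := by
    rw [← Set.vadd_set_compl, closure_vadd, sub_eq_add_neg, sub_eq_add_neg]
    exact vadd_assoc x (closure Aᶜ) (-K)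
  rw [vanHoveBoundary, h1, h2, h3, ← Set.vadd_set_sdiff, ← Set.vadd_set_inter,
    ← Set.vadd_set_union, vanHoveBoundary]

variable [MeasurableSpace G]

theorem IsVanHove.vadd [BorelSpace G] {θ : Measure G} [θ.IsAddLeftInvariant] {A : ℕ → Set G}
    (hA : IsVanHove θ A) (x : G) : IsVanHove θ fun n => x +ᵥ A n := by
  refine ⟨fun n => (hA.1 n).vadd x, fun n => ?_, fun K hK => ?_⟩
  · simpa [measure_vadd] using hA.2.1 n
  · simpa [vanHoveBoundary_vadd, measure_vadd] using hA.2.2 K hK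

theorem IsVanHove.tendsto_real {X : Type*} [AddCommGroup X] [TopologicalSpace X]
    [MeasurableSpace X] {θ : Measure X} [IsFiniteMeasureOnCompacts θ] {A : ℕ → Set X}
    (hA : IsVanHove θ A) {K : Set X} (hK : IsCompact K) :
    Tendsto (fun n => θ.real (vanHoveBoundary K (A n)) / θ.real (A n)) atTop (𝓝 0) := by
  simpa [measureReal_def, ENNReal.toReal_div, Function.comp_def] using
    (ENNReal.tendsto_toReal ENNReal.zero_ne_top).comp (hA.2.2 K hK)

theorem measure_vanHoveBoundary_ne_top {θ : Measure G} [IsFiniteMeasureOnCompacts θ]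
    {K A : Set G} (hK : IsCompact K) (hA : IsCompact A) : θ (vanHoveBoundary K A) ≠ ∞ := by
  refine ne_top_of_le_ne_top ((hA.add hK).union hA).measure_lt_top.ne (measure_mono ?_)
  exact Set.union_subset_union Set.sdiff_subset Set.inter_subset_right

theorem IsVanHove.real_pos {X : Type*} [AddCommGroup X] [TopologicalSpace X] [MeasurableSpace X]
    {θ : Measure X} [IsFiniteMeasureOnCompacts θ] {A : ℕ → Set X}
    (hA : IsVanHove θ A) (n : ℕ) : 0 < θ.real (A n) :=
  ENNReal.toReal_pos (hA.2.1 n).ne' (hA.1 n).measure_lt_top.ne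

/-- The integral of a bounded function over a set changes under a translation of the set only
by the contribution of the boundary. -/
theorem abs_setIntegral_add_left_sub_le [BorelSpace G] [T2Space G] {θ : Measure G} [θ.IsAddHaarMeasure]
    {g : G → ℝ} (hg : Continuous g) {M : ℝ} (hM : ∀ x, |g x| ≤ M) {A : Set G} (hA : IsCompact A)
    (s : G) : |(∫ y in A, g (s + y) ∂θ) - ∫ y in A, g y ∂θ| ≤
      M * θ.real (vanHoveBoundary {s} A) + M * θ.real (vanHoveBoundary {-s} A) := by
  have hM0 : 0 ≤ M := (abs_nonneg _).trans (hM 0)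
  have hB : IsCompact (s +ᵥ A) := hA.vadd s
  have e : ∫ y in A, g (s + y) ∂θ = ∫ y in s +ᵥ A, g y ∂θ := by
    rw [← (measurePreserving_add_left θ s).setIntegral_preimage_emb
      (measurableEmbedding_addLeft s) g (s +ᵥ A)]
    congr 2
    ext y
    simp [Set.mem_vadd_set]
  have hAi : IntegrableOn g A θ := hg.continuousOn.integrableOn_compact hA
  have hBi : IntegrableOn g (s +ᵥ A) θ := hg.continuousOn.integrableOn_compact hB
  have h1 := integral_inter_add_sdiff (hB.isClosed.measurableSet) hAi
  have h2 := integral_inter_add_sdiff (hA.isClosed.measurableSet) hBi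
  rw [Set.inter_comm] at h2
  have h3 : |∫ y in (s +ᵥ A) \ A, g y ∂θ| ≤ M * θ.real (vanHoveBoundary {s} A) := by
    refine (norm_setIntegral_le_of_norm_le_const
      (hB.measure_lt_top.trans_le' (measure_mono Set.sdiff_subset)) fun y _ =>
        (Real.norm_eq_abs _).trans_le (hM y)).trans ?_
    gcongr
    · exact measure_vanHoveBoundary_ne_top isCompact_singleton hA
    · rintro _ ⟨⟨a, ha, rfl⟩, hy⟩
      exact Or.inl ⟨⟨a, ha, s, rfl, add_comm _ _⟩, fun h => hy (interior_subset h)⟩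
  have h4 : |∫ y in A \ (s +ᵥ A), g y ∂θ| ≤ M * θ.real (vanHoveBoundary {-s} A) := by
    refine (norm_setIntegral_le_of_norm_le_const
      (hA.measure_lt_top.trans_le' (measure_mono Set.sdiff_subset)) fun y _ =>
        (Real.norm_eq_abs _).trans_le (hM y)).trans ?_
    gcongr
    · exact measure_vanHoveBoundary_ne_top isCompact_singleton hA
    · rintro y ⟨hyA, hy⟩
      refine Or.inr ⟨⟨y - s, subset_closure fun h => hy ⟨y - s, h, by simp⟩, -s, rfl, by simp⟩,
        hyA⟩
  rw [e, ← h1, ← h2, add_sub_add_left_eq_sub]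
  exact (abs_sub _ _).trans (add_le_add h3 h4)

/-- Unique ergodicity of a dense homomorphism into a compact group: the averages of a
continuous function along a van Hove sequence converge to its Haar integral. -/
theorem tendsto_average_of_denseRange [BorelSpace G] [T2Space G] [LocallyCompactSpace G] {θ : Measure G}
    [θ.IsAddHaarMeasure] {T : Type*} [AddCommGroup T] [TopologicalSpace T]
    [IsTopologicalAddGroup T] [CompactSpace T] [MeasurableSpace T] [BorelSpace T] (m : Measure T)
    [IsProbabilityMeasure m] [m.IsAddLeftInvariant] {j : G →+ T} (hj : Continuous j)
    (hd : DenseRange j) {Φ : T → ℝ} (hΦ : Continuous Φ) {A : ℕ → Set G} (hA : IsVanHove θ A) :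
    Tendsto (fun n => (∫ y in A n, Φ (j y) ∂θ) / θ.real (A n)) atTop (𝓝 (∫ t, Φ t ∂m)) := by
  obtain ⟨M, hM⟩ : ∃ M, ∀ t, |Φ t| ≤ M := by
    obtain ⟨M, hM⟩ := (isCompact_range hΦ).isBounded.exists_norm_le
    exact ⟨M, fun t => hM _ ⟨t, rfl⟩⟩
  set avg : ℕ → T → ℝ := fun n t => (∫ y in A n, Φ (t + j y) ∂θ) / θ.real (A n) with havg
  have hpos := hA.real_pos
  have hint : ∀ n t, IntegrableOn (fun y => Φ (t + j y)) (A n) θ := fun n t =>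
    (by fun_prop : Continuous fun y => Φ (t + j y)).continuousOn.integrableOn_compact (hA.1 n)
  -- Equicontinuity, uniform in `n`, inherited from the uniform continuity of `Φ`.
  have hequi : ∀ ε : ℝ, 0 < ε → ∀ᶠ v in 𝓝 (0 : T), ∀ n t, |avg n (t + v) - avg n t| ≤ ε := by
    intro ε hε
    filter_upwards [eventually_forall_norm_sub_lt hΦ (HasCompactSupport.of_compactSpace Φ) hε]
      with v hv n t
    rw [havg]
    simp only
    rw [← sub_div, ← integral_sub (hint n _) (hint n _), abs_div, abs_of_pos (hpos n),
      div_le_iff₀ (hpos n)]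
    rw [← Real.norm_eq_abs]
    refine norm_setIntegral_le_of_norm_le_const (hA.1 n).measure_lt_top fun y _ => ?_
    have := (hv (t + j y)).le
    rwa [add_right_comm] at this
  have hcont : ∀ n, Continuous (avg n) := by
    intro n
    rw [continuous_iff_continuousAt]
    intro t
    rw [ContinuousAt, Metric.tendsto_nhds]
    intro ε hε
    have h : Tendsto (fun u => u - t) (𝓝 t) (𝓝 0) := by
      simpa using (continuous_sub_right t).tendsto t
    filter_upwards [h.eventually (hequi (ε / 2) (half_pos hε))] with u hu
    have := hu n t
    rw [add_sub_cancel] at this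
    rw [Real.dist_eq]
    linarith
  -- Translation along the orbit costs only boundary terms, uniformly in `t`.
  have hshift : ∀ s : G, ∀ ε : ℝ, 0 < ε →
      ∀ᶠ n in atTop, ∀ t, |avg n (t + j s) - avg n t| ≤ ε := by
    intro s ε hε
    have h := ((hA.tendsto_real (isCompact_singleton (x := s))).const_mul M).add
      ((hA.tendsto_real (isCompact_singleton (x := -s))).const_mul M)
    simp only [mul_zero, add_zero] at h
    filter_upwards [h.eventually_lt_const hε] with n hn t
    have h2 := abs_setIntegral_add_left_sub_le (θ := θ) (g := fun y => Φ (t + j y))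
      (by fun_prop) (fun y => hM _) (hA.1 n) s
    simp only [map_add, ← add_assoc] at h2
    rw [havg]
    simp only
    rw [← sub_div, abs_div, abs_of_pos (hpos n), div_le_iff₀ (hpos n)]
    refine h2.trans ?_
    rw [← mul_div_assoc, ← mul_div_assoc, ← add_div, div_lt_iff₀ (hpos n)] at hn
    exact hn.le
  -- By density and compactness every `t` is close to one of finitely many orbit points, so
  -- equicontinuity and asymptotic invariance together make the averages nearly constant.
  have hosc : ∀ ε : ℝ, 0 < ε → ∀ᶠ n in atTop, ∀ t, |avg n t - avg n 0| ≤ ε := by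
    intro ε hε
    have hV := hequi (ε / 2) (half_pos hε)
    obtain ⟨F, hF⟩ : ∃ F : Finset G, ∀ t : T, ∃ s ∈ F,
        ∀ n u, |avg n (u + (t - j s)) - avg n u| ≤ ε / 2 := by
      rw [eventually_nhds_iff] at hV
      obtain ⟨V, hV, hVo, hV0⟩ := hV
      obtain ⟨F, hF⟩ := isCompact_univ.elim_finite_subcover (fun s : G => (fun t => t - j s) ⁻¹' V)
        (fun s => hVo.preimage (by fun_prop)) fun t _ => by
          obtain ⟨s, hs⟩ := hd.exists_mem_open (hVo.preimage
            (by fun_prop : Continuous fun u => t - u)) ⟨t, by simpa using hV0⟩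
          exact Set.mem_iUnion.2 ⟨s, hs⟩
      refine ⟨F, fun t => ?_⟩
      obtain ⟨s, hs, ht⟩ : ∃ s ∈ F, t - j s ∈ V := by simpa using hF (Set.mem_univ t)
      exact ⟨s, hs, hV _ ht⟩
    filter_upwards [(Filter.eventually_all_finset F).2 fun s _ => hshift s _ (half_pos hε)]
      with n hn t
    obtain ⟨s, hs, ht⟩ := hF t
    have h1 := hn s hs (t - j s)
    have h2 := ht n 0
    rw [sub_add_cancel] at h1
    rw [zero_add] at h2
    calc |avg n t - avg n 0| ≤ |avg n t - avg n (t - j s)| + |avg n (t - j s) - avg n 0| :=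
          abs_sub_le _ _ _
      _ ≤ ε := by linarith
  -- The Haar integral of each average is that of `Φ`, which identifies the nearly constant value.
  have hfub : ∀ n, ∫ t, avg n t ∂m = ∫ t, Φ t ∂m := by
    intro n
    -- The cutoff makes the integrand compactly supported, so that the Fubini theorem for continuous
    -- functions applies without measurability for the product σ-algebra.
    obtain ⟨χ, hχ1, -, hχc, -⟩ := exists_continuous_one_zero_of_isCompact (hA.1 n)
      isClosed_empty (Set.disjoint_empty _)
    have hswap := integral_integral_swap_of_hasCompactSupport
      (f := fun (t : T) (y : G) => χ y * Φ (t + j y)) (μ := m) (ν := θ.restrict (A n))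
      (by fun_prop) (HasCompactSupport.intro (isCompact_univ.prod hχc) (fun p hp => by
        have : p.2 ∉ tsupport χ := fun h => hp ⟨Set.mem_univ _, h⟩
        simp [Function.uncurry, image_eq_zero_of_notMem_tsupport this]))
    have hl : ∀ t, ∫ y in A n, χ y * Φ (t + j y) ∂θ = ∫ y in A n, Φ (t + j y) ∂θ := fun t =>
      setIntegral_congr_fun (hA.1 n).isClosed.measurableSet fun y hy => by simp [hχ1 hy]
    have hr : ∫ y in A n, ∫ t, χ y * Φ (t + j y) ∂m ∂θ = θ.real (A n) * ∫ t, Φ t ∂m := by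
      rw [← smul_eq_mul, ← setIntegral_const]
      refine setIntegral_congr_fun (hA.1 n).isClosed.measurableSet fun y hy => ?_
      simp [hχ1 hy, integral_add_right_eq_self]
    rw [hr] at hswap
    simp only [hl] at hswap
    rw [havg]
    simp only
    rw [integral_div, hswap, mul_div_cancel_left₀ _ (hpos n).ne']
  rw [Metric.tendsto_nhds]
  intro ε hε
  filter_upwards [hosc (ε / 2) (half_pos hε)] with n hn
  have h0 : (∫ y in A n, Φ (j y) ∂θ) / θ.real (A n) = avg n 0 := by simp [havg]
  have hi : Integrable (avg n) m :=
    (hcont n).integrable_of_hasCompactSupport (HasCompactSupport.of_compactSpace _)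
  rw [h0, ← hfub n, dist_comm, Real.dist_eq]
  have h1 : ∫ t, avg n t ∂m - avg n 0 = ∫ t, (avg n t - avg n 0) ∂m := by
    rw [integral_sub hi (integrable_const _)]
    simp
  have h2 := norm_integral_le_of_norm_le_const (μ := m) (f := fun t => avg n t - avg n 0)
    (C := ε / 2) (ae_of_all _ hn)
  simp only [probReal_univ, mul_one] at h2
  rw [h1]
  exact lt_of_le_of_lt h2 (half_lt_self hε)

end Averages

/-! ### Periodization over a discrete subgroup. -/

section Periodization

variable {E V : Type*} [AddCommGroup E]

/-- The sum of a function over the cosets of a subgroup. -/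
noncomputable def periodization [AddCommMonoid V] (L : AddSubgroup E) (F : E → V)
    (q : E ⧸ L) : V :=
  ∑ᶠ l : L, F (l + q.out)

/-- Another representative differs by an element of `L`, which only reindexes the sum. -/
theorem periodization_mk [AddCommMonoid V] (L : AddSubgroup E) (F : E → V) (e : E) :
    periodization L F (QuotientAddGroup.mk e) = ∑ᶠ l : L, F (l + e) := by
  obtain ⟨l₀, h⟩ := QuotientAddGroup.mk_out_eq_add L e
  rw [periodization, h, ← finsum_comp_equiv (Equiv.addRight l₀) (f := fun l : L => F (l + e))]
  refine finsum_congr fun l => ?_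
  simp only [Equiv.coe_addRight, AddSubgroup.coe_add]
  congr 1
  abel

theorem periodization_nonneg (L : AddSubgroup E) {F : E → ℝ} (hF : ∀ e, 0 ≤ F e) (q : E ⧸ L) :
    0 ≤ periodization L F q :=
  finsum_nonneg fun _ => hF _

theorem periodization_const_mul (L : AddSubgroup E) (a : ℝ) (F : E → ℝ) (q : E ⧸ L) :
    periodization L (fun e => a * F e) q = a * periodization L F q :=
  (mul_finsum _ _).symm

theorem periodization_add_right [AddCommMonoid V] (L : AddSubgroup E) (F : E → V) (a : E)
    (q : E ⧸ L) :
    periodization L (fun e => F (e + a)) q = periodization L F (q + QuotientAddGroup.mk a) := by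
  obtain ⟨e, rfl⟩ := QuotientAddGroup.mk_surjective q
  rw [← QuotientAddGroup.mk_add, periodization_mk, periodization_mk]
  simp only [add_assoc]

variable [TopologicalSpace E]

theorem compactSpace_quotient {L : AddSubgroup E} (hL : RelativelyDense (L : Set E)) :
    CompactSpace (E ⧸ L) := by
  obtain ⟨K, hK, e⟩ := hL
  refine ⟨?_⟩
  have : (QuotientAddGroup.mk '' K : Set (E ⧸ L)) = Set.univ := by
    refine Set.eq_univ_of_forall fun q => ?_
    obtain ⟨x, rfl⟩ := QuotientAddGroup.mk_surjective q
    obtain ⟨l, hl, k, hk, rfl⟩ : x ∈ (L : Set E) + K := e ▸ Set.mem_univ x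
    exact ⟨k, hk, QuotientAddGroup.eq.2 (by simpa [add_comm] using hl)⟩
  rw [← this]
  exact hK.image continuous_quot_mk

variable [IsTopologicalAddGroup E]

theorem isCompact_sub {C D : Set E} (hC : IsCompact C) (hD : IsCompact D) : IsCompact (C - D) :=
  sub_eq_add_neg C D ▸ hC.add hD.neg

variable [T2Space E]

theorem finite_coe_mem_of_isCompact (L : AddSubgroup E) [DiscreteTopology L] {C : Set E}
    (hC : IsCompact C) : {l : L | (l : E) ∈ C}.Finite := by
  have hcl : IsClosed (L : Set E) := AddSubgroup.isClosed_of_discrete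
  exact (hcl.isClosedEmbedding_subtypeVal.isCompact_preimage hC).finite_of_discrete

theorem IsLattice.finite_inter {L : AddSubgroup E} (hL : IsLattice L) {C : Set E}
    (hC : IsCompact C) : ((L : Set E) ∩ C).Finite := by
  have := hL.1
  refine ((finite_coe_mem_of_isCompact L hC).image Subtype.val).subset ?_
  rintro x ⟨hx, hxC⟩
  exact ⟨⟨x, hx⟩, hxC, rfl⟩

theorem locallyFinite_support_add (L : AddSubgroup E) [DiscreteTopology L]
    [LocallyCompactSpace E] [Zero V] {F : E → V} (hc : HasCompactSupport F) :
    LocallyFinite fun l : L => Function.support fun e => F (l + e) := by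
  intro e
  obtain ⟨C, hC, heC⟩ := exists_compact_mem_nhds e
  refine ⟨C, heC, (finite_coe_mem_of_isCompact L (isCompact_sub hc.isCompact hC)).subset ?_⟩
  rintro l ⟨c, hl, hcC⟩
  exact ⟨l + c, subset_tsupport F hl, c, hcC, by simp⟩

theorem finite_support_add [Zero V] (L : AddSubgroup E) [DiscreteTopology L] {F : E → V}
    (hc : HasCompactSupport F) (e : E) : (Function.support fun l : L => F (l + e)).Finite := by
  refine (finite_coe_mem_of_isCompact L
    (isCompact_sub hc.isCompact (isCompact_singleton (x := e)))).subset ?_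
  intro l hl
  exact ⟨l + e, subset_tsupport F hl, e, rfl, by simp⟩

theorem continuous_periodization [AddCommMonoid V] [TopologicalSpace V] [ContinuousAdd V]
    (L : AddSubgroup E) [DiscreteTopology L] [LocallyCompactSpace E] {F : E → V}
    (hF : Continuous F) (hc : HasCompactSupport F) :
    Continuous (periodization L F) := by
  rw [(QuotientAddGroup.isQuotientMap_mk (N := L)).continuous_iff]
  have : periodization L F ∘ QuotientAddGroup.mk = fun e => ∑ᶠ l : L, F (l + e) :=
    funext (periodization_mk L F)
  rw [this]
  exact continuous_finsum (fun l => by fun_prop) (locallyFinite_support_add L hc)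

theorem le_periodization (L : AddSubgroup E) [DiscreteTopology L] {F : E → ℝ}
    (hc : HasCompactSupport F) (hF : ∀ e, 0 ≤ F e) (e : E) :
    F e ≤ periodization L F (QuotientAddGroup.mk e) := by
  rw [periodization_mk]
  have := single_le_finsum (f := fun l : L => F (l + e)) 0 (finite_support_add L hc e)
    fun _ => hF _
  simpa using this

theorem periodization_add (L : AddSubgroup E) [DiscreteTopology L] {F F' : E → ℝ}
    (hc : HasCompactSupport F) (hc' : HasCompactSupport F') (q : E ⧸ L) :
    periodization L (fun e => F e + F' e) q = periodization L F q + periodization L F' q :=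
  finsum_add_distrib (finite_support_add L hc _) (finite_support_add L hc' _)

end Periodization

/-! ### Comparing the mass of a set with the integral of a smoothed measure. -/

section Counting

variable {G : Type*} [AddCommGroup G] [TopologicalSpace G] [IsTopologicalAddGroup G] [T2Space G]
  [MeasurableSpace G] [BorelSpace G]

/-- The mass of a compact set differs from the integral of a smoothing of the measure by at most
the contribution of the boundary. -/
theorem abs_measureReal_sub_setIntegral_le {θ : Measure G} [θ.IsAddHaarMeasure] {ν : Measure G}
    [IsFiniteMeasureOnCompacts ν] {S : Set G} (hS : LocFinite S) (h0 : ν Sᶜ = 0) {f : G → ℝ}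
    (hf : Continuous f) (hf0 : ∀ x, 0 ≤ f x) {K : Set G} (hK : IsCompact K) (hK0 : (0 : G) ∈ K)
    (hfK : ∀ x, f x ≠ 0 → x ∈ K ∧ -x ∈ K) (hf1 : ∫ x, f (-x) ∂θ = 1) {R : G → ℝ}
    (hR : ∀ y, ∀ F : Finset G, (∀ x ∈ S, f (x - y) ≠ 0 → x ∈ F) →
      R y = ∑ x ∈ F, ν.real {x} * f (x - y)) {M : ℝ} (hM : ∀ y, |R y| ≤ M)
    {A : Set G} (hA : IsCompact A) :
    |ν.real A - ∫ y in A, R y ∂θ| ≤ M * θ.real (vanHoveBoundary K A) := by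
  classical
  have hD : IsCompact (A + K) := hA.add hK
  obtain ⟨F, hF⟩ := (hS _ (hD.add hK)).exists_finset
  have hAD : A ⊆ A + K := fun a ha => ⟨a, ha, 0, hK0, add_zero a⟩
  have hfc : ∀ x, HasCompactSupport fun y => f (x - y) := fun x =>
    HasCompactSupport.intro ((isCompact_singleton (x := x)).add hK) fun y hy => by
      by_contra h
      exact hy ⟨x, rfl, _, (hfK _ h).2, by simp⟩
  have hfi : ∀ x, Integrable (fun y => f (x - y)) θ := fun x =>
    (by fun_prop : Continuous fun y => f (x - y)).integrable_of_hasCompactSupport (hfc x)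
  have htot : ∀ x, ∫ y, f (x - y) ∂θ = 1 := by
    intro x
    rw [← hf1, ← integral_sub_right_eq_self (fun y => f (-y)) x]
    simp
  -- `B` holds the `y` near `A` whose `K`-neighbourhood is not inside `A`. Only for such `y` can
  -- replacing the indicator of `A` at `x` by that at `y` matter in front of `f (x - y)`.
  set B : Set G := (A + K) \ {y | ∀ k ∈ K, y + k ∈ A} with hBdef
  have hBm : MeasurableSet B := by
    refine hD.isClosed.measurableSet.diff (IsClosed.measurableSet ?_)
    have : {y | ∀ k ∈ K, y + k ∈ A} = ⋂ k ∈ K, (fun y => y + k) ⁻¹' A := by ext; simp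
    rw [this]
    exact isClosed_biInter fun k _ => hA.isClosed.preimage (continuous_add_const k)
  have hBsub : B ⊆ vanHoveBoundary K A := by
    rintro y ⟨hy, hyk⟩
    by_cases hyA : y ∈ A
    · obtain ⟨k, hk, hykA⟩ : ∃ k ∈ K, y + k ∉ A := by simpa using hyk
      exact Or.inr ⟨⟨y + k, subset_closure hykA, k, hk, by simp⟩, hyA⟩
    · exact Or.inl ⟨hy, fun h => hyA (interior_subset h)⟩
  have hBD : B ⊆ A + K := Set.sdiff_subset
  have hRF : ∀ y ∈ A + K, R y = ∑ x ∈ F, ν.real {x} * f (x - y) := fun y hy =>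
    hR y F fun x hx h => (hF x).2 ⟨hx, y, hy, _, (hfK _ h).1, by simp⟩
  have hRint : ∀ C : Set G, MeasurableSet C → C ⊆ A + K →
      ∫ y in C, R y ∂θ = ∑ x ∈ F, ν.real {x} * ∫ y in C, f (x - y) ∂θ := by
    intro C hC hCD
    rw [setIntegral_congr_fun hC fun y hy => hRF y (hCD hy),
      integral_finsetSum F fun x _ => ((hfi x).const_mul (ν.real {x})).integrableOn]
    exact Finset.sum_congr rfl fun x _ => integral_const_mul _ _
  have hνA : ν.real A = ∑ x ∈ F, ν.real {x} * A.indicator 1 x := by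
    rw [measureReal_eq_sum (S := S) h0 (B := A) (F.filter (· ∈ A)) (fun x hx => by simp_all)
      (fun x hx hxS hxF => ?_) (hS A hA), Finset.sum_filter]
    · refine Finset.sum_congr rfl fun x _ => ?_
      by_cases hx : x ∈ A <;> simp [hx]
    · refine absurd (Finset.mem_filter.2 ⟨(hF x).2 ⟨hxS, x, hAD hx, 0, hK0, ?_⟩, hx⟩) hxF
      exact add_zero x
  have hAm := hA.isClosed.measurableSet
  have hpt : ∀ x, |A.indicator 1 x - ∫ y in A, f (x - y) ∂θ| ≤ ∫ y in B, f (x - y) ∂θ := by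
    intro x
    have e1 : A.indicator 1 x - ∫ y in A, f (x - y) ∂θ =
        ∫ y, (A.indicator 1 x * f (x - y) - A.indicator (fun y => f (x - y)) y) ∂θ := by
      rw [integral_sub ((hfi x).const_mul _) ((hfi x).indicator hAm), integral_const_mul, htot,
        integral_indicator hAm, mul_one]
    rw [e1, ← integral_indicator hBm]
    rw [← Real.norm_eq_abs]
    refine norm_integral_le_of_norm_le ((hfi x).indicator hBm) (ae_of_all _ fun y => ?_)
    rw [Real.norm_eq_abs]
    by_cases hxy : f (x - y) = 0
    · by_cases hyA : y ∈ A <;> by_cases hyB : y ∈ B <;> simp [hyA, hyB, hxy]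
    have hk := hfK _ hxy
    have hnn := hf0 (x - y)
    by_cases hxA : x ∈ A <;> by_cases hyA : y ∈ A
    · by_cases hyB : y ∈ B <;> simp [hxA, hyA, hyB, hnn]
    · have hyB : y ∈ B := ⟨⟨x, hxA, _, hk.2, by simp⟩, fun h => hyA (by simpa using h 0 hK0)⟩
      simp [hxA, hyA, hyB, abs_of_nonneg hnn]
    · have hyB : y ∈ B := ⟨hAD hyA, fun h => hxA (by simpa using h _ hk.1)⟩
      simp [hxA, hyA, hyB, abs_of_nonneg hnn]
    · by_cases hyB : y ∈ B <;> simp [hxA, hyA, hyB, hnn]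
  have hM0 : 0 ≤ M := (abs_nonneg _).trans (hM 0)
  -- Summed against the masses of `ν`, the pointwise errors reassemble to the integral of `R` over
  -- `B`, where the bound `M` applies.
  calc |ν.real A - ∫ y in A, R y ∂θ|
      = |∑ x ∈ F, ν.real {x} * (A.indicator 1 x - ∫ y in A, f (x - y) ∂θ)| := by
        rw [hνA, hRint A hAm hAD, ← Finset.sum_sub_distrib]
        simp only [mul_sub]
    _ ≤ ∑ x ∈ F, ν.real {x} * ∫ y in B, f (x - y) ∂θ := by
        refine (Finset.abs_sum_le_sum_abs _ _).trans (Finset.sum_le_sum fun x _ => ?_)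
        rw [abs_mul, abs_of_nonneg measureReal_nonneg]
        exact mul_le_mul_of_nonneg_left (hpt x) measureReal_nonneg
    _ = ∫ y in B, R y ∂θ := (hRint B hBm hBD).symm
    _ ≤ M * θ.real B := by
        refine (le_abs_self _).trans ?_
        rw [← Real.norm_eq_abs]
        exact norm_setIntegral_le_of_norm_le_const
          (hD.measure_lt_top.trans_le' (measure_mono hBD)) fun y _ => hM y
    _ ≤ _ := by
        gcongr
        exact measure_vanHoveBoundary_ne_top hK hA

end Counting

/-! ### Invariant functionals and uniqueness of Haar measure. -/

section InvariantFunctional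

/-- A positive translation invariant linear functional on the compactly supported continuous
functions is a multiple of the Haar integral. -/
theorem exists_forall_eq_mul_integral {H : Type*} [AddCommGroup H] [TopologicalSpace H]
    [IsTopologicalAddGroup H] [T2Space H] [LocallyCompactSpace H] [MeasurableSpace H]
    [BorelSpace H] (μ : Measure H) [μ.IsAddHaarMeasure] (I : (H → ℝ) → ℝ)
    (hadd : ∀ f g : H → ℝ, Continuous f → HasCompactSupport f → Continuous g →
      HasCompactSupport g → I (fun h => f h + g h) = I f + I g)
    (hmul : ∀ (a : ℝ) (f : H → ℝ), I (fun h => a * f h) = a * I f)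
    (hnonneg : ∀ f : H → ℝ, (∀ h, 0 ≤ f h) → 0 ≤ I f)
    (hinv : ∀ (a : H) (f : H → ℝ), Continuous f → HasCompactSupport f →
      I (fun h => f (a + h)) = I f) :
    ∃ c : ℝ, ∀ f : H → ℝ, Continuous f → HasCompactSupport f → I f = c * ∫ h, f h ∂μ := by
  -- The Riesz representation turns `I` into a regular measure; invariance of `I` makes it
  -- translation invariant, and uniqueness of Haar measure supplies the factor.
  let Λ : CompactlySupportedContinuousMap H ℝ →ₚ[ℝ] ℝ := PositiveLinearMap.mk₀
    { toFun := fun f => I f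
      map_add' := fun f g => hadd f g f.continuous f.hasCompactSupport g.continuous
        g.hasCompactSupport
      map_smul' := fun a f => hmul a f } fun f hf => hnonneg f hf
  have hΛ : ∀ (f : H → ℝ) (hf : Continuous f) (hc : HasCompactSupport f),
      ∫ h, f h ∂(RealRMK.rieszMeasure Λ) = I f := fun f hf hc =>
    RealRMK.integral_rieszMeasure Λ ⟨⟨f, hf⟩, hc⟩
  have hleft : (RealRMK.rieszMeasure Λ).IsAddLeftInvariant := by
    refine ⟨fun a => ?_⟩
    have : (Measure.map (fun x => a + x) (RealRMK.rieszMeasure Λ)).Regular :=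
      Measure.Regular.map (Homeomorph.addLeft a)
    refine Measure.ext_of_integral_eq_on_compactlySupported fun f => ?_
    rw [integral_map (f := (f : H → ℝ)) (by fun_prop) f.continuous.aestronglyMeasurable,
      hΛ f f.continuous f.hasCompactSupport, ← hinv a f f.continuous f.hasCompactSupport]
    exact hΛ _ (by fun_prop) (f.hasCompactSupport.comp_homeomorph (Homeomorph.addLeft a))
  refine ⟨Measure.addHaarScalarFactor (RealRMK.rieszMeasure Λ) μ, fun f hf hc => ?_⟩
  rw [← hΛ f hf hc, Measure.integral_isAddLeftInvariant_eq_smul_of_hasCompactSupport _ μ hf hc,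
    integral_smul_nnreal_measure]
  rfl

end InvariantFunctional

/-! ### The orbit of the physical group in the torus. -/

section Orbit

variable {G H : Type*} [AddCommGroup G] [AddCommGroup H]

/-- The embedding of the physical group into the torus of a cut and project scheme. -/
def orbitHom (L : AddSubgroup (G × H)) : G →+ (G × H) ⧸ L :=
  (QuotientAddGroup.mk' L).comp (AddMonoidHom.inl G H)

variable [TopologicalSpace G] [TopologicalSpace H]

theorem continuous_orbitHom (L : AddSubgroup (G × H)) : Continuous (orbitHom L) := by
  have : Continuous fun y : G => ((y, 0) : G × H) := by fun_prop
  exact continuous_quot_mk.comp this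

/-- Subtracting a lattice vector `(x, y)` moves `(g', y)` to `(g' - x, 0)`. The orbit thus contains
the image of `G` times the projected lattice, which is dense. -/
theorem denseRange_orbitHom {L : AddSubgroup (G × H)}
    (hL : Dense (Prod.snd '' (L : Set (G × H)))) : DenseRange (orbitHom L) := by
  intro q
  obtain ⟨⟨g, h⟩, rfl⟩ := QuotientAddGroup.mk_surjective q
  have h1 : (g, h) ∈ closure ((Set.univ : Set G) ×ˢ (Prod.snd '' (L : Set (G × H)))) := by
    rw [closure_prod_eq]
    exact ⟨subset_closure trivial, hL h⟩
  refine closure_mono ?_ (image_closure_subset_closure_image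
    (continuous_quot_mk : Continuous (QuotientAddGroup.mk : G × H → (G × H) ⧸ L))
    ⟨_, h1, rfl⟩)
  rintro _ ⟨⟨g', h'⟩, ⟨-, ⟨⟨x, y⟩, hxy, rfl⟩⟩, rfl⟩
  refine ⟨g' - x, QuotientAddGroup.eq.2 ?_⟩
  simpa using hxy

end Orbit

/-! ### Uniform distribution of weighted combs. -/

section Density

variable {G H : Type*} [AddCommGroup G] [TopologicalSpace G] [IsTopologicalAddGroup G] [T2Space G]
  [LocallyCompactSpace G] [MeasurableSpace G] [BorelSpace G] [AddCommGroup H] [TopologicalSpace H]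
  [IsTopologicalAddGroup H] [T2Space H] [LocallyCompactSpace H] [MeasurableSpace H] [BorelSpace H]

/-- `ν` is the measure on `G` that a cut and project scheme and a weight function on the internal
group define. -/
structure IsWeightedModelComb (C : CutProjectScheme G H) (φ : H → ℝ) (ν : Measure G) : Prop where
  finiteOnCompacts : IsFiniteMeasureOnCompacts ν
  carrier : ∃ S : Set G, LocFinite S ∧ ν Sᶜ = 0
  apply_lattice : ∀ x y, (x, y) ∈ C.lattice → ν.real {x} = φ y
  apply_other : ∀ x, (∀ y, (x, y) ∉ C.lattice) → ν.real {x} = 0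

/-- Uniform distribution of model combs: the mean of a model comb is proportional to the Haar
integral of its weight function. -/
theorem exists_density (θ : Measure G) [θ.IsAddHaarMeasure] (C : CutProjectScheme G H)
    (μ : Measure H) [μ.IsAddHaarMeasure] :
    ∃ d : ℝ, 0 < d ∧ ∀ φ : H → ℝ, Continuous φ → HasCompactSupport φ →
      ∀ ν : Measure G, IsWeightedModelComb C φ ν → ∀ A : ℕ → Set G, IsVanHove θ A →
        Tendsto (fun n => ν.real (A n) / θ.real (A n)) atTop (𝓝 (d * ∫ h, φ h ∂μ)) := by
  -- A bump with the normalization that lets smoothing preserve mass up to boundary terms;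
  -- positivity at `0` serves to show `0 < d`.
  obtain ⟨f, hf, hfc, hf0, hfpos, hf1⟩ : ∃ f : G → ℝ, Continuous f ∧ HasCompactSupport f ∧
      (∀ x, 0 ≤ f x) ∧ 0 < f 0 ∧ ∫ x, f (-x) ∂θ = 1 := by
    obtain ⟨g, hgc, hg0, hgn⟩ := exists_continuous_nonneg_pos (0 : G)
    have hgpos : 0 < ∫ x, g (-x) ∂θ :=
      Continuous.integral_pos_of_hasCompactSupport_nonneg_nonzero (x := 0)
        (by fun_prop) (hgc.comp_homeomorph (Homeomorph.neg G)) (fun x => hg0 (-x)) (by simpa)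
    refine ⟨fun x => g x / ∫ x, g (-x) ∂θ, by fun_prop, ?_, fun x => div_nonneg (hg0 x) hgpos.le,
      div_pos (lt_of_le_of_ne (hg0 0) (Ne.symm hgn)) hgpos, ?_⟩
    · simp only [div_eq_mul_inv]
      exact hgc.mul_right (f' := fun _ => (∫ x, g (-x) ∂θ)⁻¹)
    · rw [integral_div, div_self hgpos.ne']
  obtain ⟨K, hK, hK0, hfK⟩ : ∃ K : Set G, IsCompact K ∧ (0 : G) ∈ K ∧
      ∀ x, f x ≠ 0 → x ∈ K ∧ -x ∈ K := by
    refine ⟨tsupport f ∪ -tsupport f ∪ {0}, (hfc.isCompact.union hfc.isCompact.neg).union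
      isCompact_singleton, Or.inr rfl, fun x hx => ?_⟩
    have := subset_tsupport f hx
    exact ⟨Or.inl (Or.inl this), Or.inl (Or.inr (by simpa using this))⟩
  set L := C.lattice
  have hdisc : DiscreteTopology L := C.isLattice.1
  have hcomp : CompactSpace ((G × H) ⧸ L) := compactSpace_quotient C.isLattice.2
  borelize ((G × H) ⧸ L)
  let m : Measure ((G × H) ⧸ L) := Measure.addHaarMeasure ⊤
  have hm : IsProbabilityMeasure m := ⟨Measure.addHaarMeasure_self⟩
  set F : (H → ℝ) → G × H → ℝ := fun φ p => f p.1 * φ p.2 with hF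
  have hFcont : ∀ φ : H → ℝ, Continuous φ → Continuous (F φ) := fun φ hφ => by
    rw [hF]; fun_prop
  have hFcomp : ∀ φ : H → ℝ, HasCompactSupport φ → HasCompactSupport (F φ) := fun φ hφ =>
    HasCompactSupport.intro (hfc.isCompact.prod hφ.isCompact) fun p hp => by
      by_cases h1 : p.1 ∈ tsupport f
      · have : p.2 ∉ tsupport φ := fun h2 => hp ⟨h1, h2⟩
        simp [hF, image_eq_zero_of_notMem_tsupport this]
      · simp [hF, image_eq_zero_of_notMem_tsupport h1]
  have hPcont : ∀ φ : H → ℝ, Continuous φ → HasCompactSupport φ →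
      Continuous (periodization L (F φ)) := fun φ hφ hc =>
    continuous_periodization L (hFcont φ hφ) (hFcomp φ hc)
  have hPint : ∀ φ : H → ℝ, Continuous φ → HasCompactSupport φ →
      Integrable (periodization L (F φ)) m := fun φ hφ hc =>
    (hPcont φ hφ hc).integrable_of_hasCompactSupport (HasCompactSupport.of_compactSpace _)
  -- As a functional of `φ`, the torus integral of the periodized product `f ⊗ φ` is positive.
  -- Translating `φ` by `a` translates the torus by the class of `(0, a)`, so the functional is
  -- invariant and hence a multiple of Haar measure on `H`.
  obtain ⟨d, hd⟩ := exists_forall_eq_mul_integral μ (fun φ => ∫ q, periodization L (F φ) q ∂m)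
    (fun φ ψ hφ hφc hψ hψc => by
      rw [← integral_add (hPint φ hφ hφc) (hPint ψ hψ hψc)]
      refine integral_congr_ae (ae_of_all _ fun q => ?_)
      have := periodization_add L (hFcomp φ hφc) (hFcomp ψ hψc) q
      simpa only [hF, mul_add] using this)
    (fun a φ => by
      rw [← integral_const_mul]
      refine integral_congr_ae (ae_of_all _ fun q => ?_)
      simp only [← periodization_const_mul, hF, mul_left_comm])
    (fun φ hφ => integral_nonneg fun q => periodization_nonneg L
      (fun p => mul_nonneg (hf0 _) (hφ _)) q)
    (fun a φ hφ hφc => by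
      rw [← integral_add_right_eq_self (μ := m) (periodization L (F φ))
        (QuotientAddGroup.mk ((0, a) : G × H))]
      refine integral_congr_ae (ae_of_all _ fun q => ?_)
      simp only [← periodization_add_right, hF, Prod.fst_add, Prod.snd_add, add_zero, add_comm])
  refine ⟨d, ?_, fun φ hφ hφc ν hν A hA => ?_⟩
  · obtain ⟨g, hgc, hg0, hgn⟩ := exists_continuous_nonneg_pos (0 : H)
    have h1 : 0 < ∫ q, periodization L (F g) q ∂m := by
      refine Continuous.integral_pos_of_hasCompactSupport_nonneg_nonzero
        (x := QuotientAddGroup.mk (0 : G × H)) (hPcont g g.continuous hgc)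
        (HasCompactSupport.of_compactSpace _)
        (fun q => periodization_nonneg L (fun p => mul_nonneg (hf0 _) (hg0 _)) q) ?_
      refine (lt_of_lt_of_le ?_ (le_periodization L (hFcomp g hgc)
        (fun p => mul_nonneg (hf0 _) (hg0 _)) 0)).ne'
      exact mul_pos hfpos (lt_of_le_of_ne (hg0 0) (Ne.symm hgn))
    have h2 := hd g g.continuous hgc
    rw [h2] at h1
    exact pos_of_mul_pos_left h1 (integral_nonneg hg0)
  · have hνfin := hν.finiteOnCompacts
    obtain ⟨S, hS, hS0⟩ := hν.carrier
    -- The smoothed comb at `y` sums over the lattice shifted by `(-y, 0)`, so the orbit is run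
    -- through backwards.
    let j : G →+ (G × H) ⧸ L := (orbitHom L).comp (negAddMonoidHom (α := G))
    have hjc : Continuous j := (continuous_orbitHom L).comp continuous_neg
    have hjd : DenseRange j := (denseRange_orbitHom C.dense_snd).comp
      neg_surjective.denseRange (continuous_orbitHom L)
    set R : G → ℝ := fun y => periodization L (F φ) (j y) with hRdef
    obtain ⟨M, hM⟩ : ∃ M, ∀ t, |periodization L (F φ) t| ≤ M := by
      obtain ⟨M, hM⟩ := (isCompact_range (hPcont φ hφ hφc)).isBounded.exists_norm_le
      exact ⟨M, fun t => hM _ ⟨t, rfl⟩⟩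
    have hR : ∀ y, ∀ Fs : Finset G, (∀ x ∈ S, f (x - y) ≠ 0 → x ∈ Fs) →
        R y = ∑ x ∈ Fs, ν.real {x} * f (x - y) := by
      intro y Fs hFs
      have hsupp : Function.support (fun x => ν.real {x} * f (x - y)) ⊆ Fs := by
        intro x hx
        have hx1 : ν.real {x} ≠ 0 := left_ne_zero_of_mul hx
        refine hFs x (by_contra fun hxS => hx1 ?_) (right_ne_zero_of_mul hx)
        rw [measureReal_def, measure_mono_null (Set.singleton_subset_iff.2 hxS) hS0,
          ENNReal.toReal_zero]
      have hinj : Function.Injective fun l : L => (l : G × H).1 := fun a b hab =>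
        Subtype.ext (C.injOn_fst a.2 b.2 hab)
      rw [← finsum_eq_sum_of_support_subset _ hsupp, hRdef]
      simp only
      rw [show j y = QuotientAddGroup.mk ((-y, 0) : G × H) from rfl, periodization_mk]
      rw [← finsum_mem_univ (f := fun x => ν.real {x} * f (x - y)),
        ← finsum_mem_inter_support_eq' (s := Set.range fun l : L =>
        (l : G × H).1) (t := Set.univ) _ (fun x hx => ?_), finsum_mem_range hinj]
      · refine finsum_congr fun l => ?_
        rw [hν.apply_lattice _ (l : G × H).2 l.2]
        simp [hF, sub_eq_add_neg, mul_comm]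
      · refine iff_of_true ?_ trivial
        by_contra hxr
        refine left_ne_zero_of_mul hx (hν.apply_other x fun z hz => hxr ⟨⟨_, hz⟩, rfl⟩)
    have hlim := tendsto_average_of_denseRange m hjc hjd (hPcont φ hφ hφc) hA
    have hd' : ∫ q, periodization L (F φ) q ∂m = d * ∫ h, φ h ∂μ := hd φ hφ hφc
    rw [hd'] at hlim
    have herr : Tendsto (fun n => ν.real (A n) / θ.real (A n) -
        (∫ y in A n, R y ∂θ) / θ.real (A n)) atTop (𝓝 0) := by
      have h0 := (hA.tendsto_real hK).const_mul M
      rw [mul_zero] at h0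
      refine squeeze_zero_norm (fun n => ?_) h0
      rw [← sub_div, norm_div, Real.norm_eq_abs, Real.norm_eq_abs, abs_of_pos (hA.real_pos n),
        ← mul_div_assoc]
      exact div_le_div_of_nonneg_right (abs_measureReal_sub_setIntegral_le hS hS0 hf hf0 hK hK0
        hfK hf1 hR (fun y => hM _) (hA.1 n)) (hA.real_pos n).le
    simpa [hRdef] using herr.add hlim

end Density

/-! ### Almost periodicity from a compact group. -/

section AlmostPeriodic

/-- A continuous function on a compact group restricts to an almost periodic function along a
dense continuous homomorphism. -/
theorem isAlmostPeriodic_comp_of_denseRange {G T : Type*} [AddCommGroup G] [TopologicalSpace G]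
    [AddCommGroup T] [TopologicalSpace T] [IsTopologicalAddGroup T] [CompactSpace T] {j : G →+ T}
    (hj : Continuous j) (hd : DenseRange j) {Φ : T → ℂ} (hΦ : Continuous Φ) :
    IsAlmostPeriodic fun x => Φ (j x) := by
  refine ⟨hΦ.comp hj, fun ε hε => ?_⟩
  have hV := eventually_forall_norm_sub_lt hΦ (HasCompactSupport.of_compactSpace Φ) hε
  rw [eventually_nhds_iff] at hV
  obtain ⟨V, hV, hVo, hV0⟩ := hV
  -- Finitely many translates of `V`, centred on the orbit, cover the compact group; so every `x` is
  -- an `ε`-period plus one of finitely many `s`.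
  obtain ⟨F, hF⟩ := isCompact_univ.elim_finite_subcover (fun s : G => (fun t => t - j s) ⁻¹' V)
    (fun s => hVo.preimage (by fun_prop)) fun t _ => by
      obtain ⟨s, hs⟩ := hd.exists_mem_open (hVo.preimage
        (by fun_prop : Continuous fun u => t - u)) ⟨t, by simpa using hV0⟩
      exact Set.mem_iUnion.2 ⟨s, hs⟩
  refine ⟨F, F.finite_toSet.isCompact, Set.eq_univ_of_forall fun x => ?_⟩
  obtain ⟨s, hs, hx⟩ : ∃ s ∈ F, j x - j s ∈ V := by simpa using hF (Set.mem_univ (j x))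
  refine ⟨x - s, fun y => ?_, s, hs, by simp⟩
  simpa using hV _ hx (j y)

end AlmostPeriodic

/-! ### Projection sets of a cut and project scheme. -/

namespace CutProjectScheme

variable {G H : Type*} [AddCommGroup G] [TopologicalSpace G] [AddCommGroup H] [TopologicalSpace H]
  (C : CutProjectScheme G H)

theorem snd_unique {x : G} {y z : H} (hy : (x, y) ∈ C.lattice) (hz : (x, z) ∈ C.lattice) :
    y = z :=
  congrArg Prod.snd (C.injOn_fst hy hz rfl)

theorem injective_fst : Function.Injective fun l : C.lattice => (l : G × H).1 := fun a b hab =>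
  Subtype.ext (C.injOn_fst a.2 b.2 hab)

theorem exists_mem_of_isOpen {U : Set H} (hU : IsOpen U) (hne : U.Nonempty) :
    ∃ x, ∃ y ∈ U, (x, y) ∈ C.lattice := by
  obtain ⟨_, hyU, ⟨⟨x, y⟩, hxy, rfl⟩⟩ := C.dense_snd.inter_open_nonempty U hU hne
  exact ⟨x, y, hyU, hxy⟩

theorem oplam_sub_subset (A B : Set H) : C.oplam A - C.oplam B ⊆ C.oplam (A - B) := by
  rintro _ ⟨x, ⟨y, hy, hxy⟩, x', ⟨y', hy', hxy'⟩, rfl⟩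
  exact ⟨y - y', ⟨y, hy, y', hy', rfl⟩, C.lattice.sub_mem hxy hxy'⟩

variable [IsTopologicalAddGroup G] [IsTopologicalAddGroup H]

theorem locFinite_oplam [T2Space G] [T2Space H] {A : Set H} (hA : IsCompact A) :
    LocFinite (C.oplam A) := by
  intro K hK
  refine ((C.isLattice.finite_inter (hK.prod hA)).image Prod.fst).subset ?_
  rintro x ⟨⟨y, hy, hxy⟩, hx⟩
  exact ⟨(x, y), ⟨hxy, hx, hy⟩, rfl⟩

/-- Cocompactness writes `(x, 0)` as a lattice vector plus some `k` in a compact set. The star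
coordinate `-k₂` of that vector ranges over a compact set, so one of finitely many lattice vectors
corrects it into `U`. -/
theorem relativelyDense_oplam {U : Set H} (hU : IsOpen U) (hne : U.Nonempty) :
    RelativelyDense (C.oplam U) := by
  obtain ⟨K, hK, hLK⟩ := C.isLattice.2
  have hK2 : IsCompact (Prod.snd '' K) := hK.image continuous_snd
  obtain ⟨F, hF⟩ := hK2.elim_finite_subcover
    (fun l : C.lattice => (fun k => (l : G × H).2 - k) ⁻¹' U)
    (fun l => hU.preimage (by fun_prop)) fun k _ => by
      obtain ⟨x, y, hy, hxy⟩ := C.exists_mem_of_isOpen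
        (hU.preimage (by fun_prop : Continuous fun u => u - k)) (by
          obtain ⟨u, hu⟩ := hne
          exact ⟨u + k, by simpa using hu⟩)
      exact Set.mem_iUnion.2 ⟨⟨(x, y), hxy⟩, hy⟩
  have hc : IsCompact (Prod.fst '' K - (fun l : C.lattice => (l : G × H).1) '' F) :=
    isCompact_sub (hK.image continuous_fst) (F.finite_toSet.image _).isCompact
  refine ⟨_, hc, Set.eq_univ_of_forall fun x => ?_⟩
  obtain ⟨⟨a, b⟩, hab, ⟨k₁, k₂⟩, hk, e⟩ : (x, (0 : H)) ∈ (C.lattice : Set (G × H)) + K :=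
    hLK ▸ Set.mem_univ _
  simp only [Prod.mk_add_mk, Prod.mk.injEq] at e
  obtain ⟨l, hl, hlU⟩ : ∃ l ∈ F, (l : G × H).2 - k₂ ∈ U := by
    simpa only [Set.mem_iUnion, Set.mem_preimage, exists_prop] using hF ⟨_, hk, rfl⟩
  refine ⟨a + (l : G × H).1, ⟨b + (l : G × H).2, ?_, C.lattice.add_mem hab l.2⟩,
    k₁ - (l : G × H).1, ⟨k₁, ⟨_, hk, rfl⟩, _, ⟨l, hl, rfl⟩, rfl⟩, ?_⟩
  · rw [eq_neg_of_add_eq_zero_left e.2]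
    simpa [sub_eq_add_neg, add_comm] using hlU
  · simp only [← e.1]
    abel

end CutProjectScheme

/-! ### Weighted model combs and their almost periodicity. -/

section CombKernel

/-- The function on the product of the groups whose periodization is the convolution of a model
comb with a test function. -/
def combKernel {G H : Type*} [Neg H] (φ : H → ℝ) (f : G → ℂ) (p : G × H) : ℂ :=
  φ (-p.2) * f p.1

theorem continuous_combKernel {G H : Type*} [TopologicalSpace G] [TopologicalSpace H] [Neg H]
    [ContinuousNeg H] {φ : H → ℝ} (hφ : Continuous φ) {f : G → ℂ} (hf : Continuous f) :
    Continuous (combKernel φ f) := by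
  unfold combKernel
  fun_prop

theorem hasCompactSupport_combKernel {G H : Type*} [TopologicalSpace G] [R1Space G]
    [TopologicalSpace H] [R1Space H] [InvolutiveNeg H] [ContinuousNeg H] {φ : H → ℝ}
    (hc : HasCompactSupport φ) {f : G → ℂ} (hfc : HasCompactSupport f) :
    HasCompactSupport (combKernel φ f) :=
  HasCompactSupport.intro (hfc.isCompact.prod hc.isCompact.neg) fun p hp => by
    by_cases h1 : p.1 ∈ tsupport f
    · have : -p.2 ∉ tsupport φ := fun h2 => hp ⟨h1, h2⟩
      simp [combKernel, image_eq_zero_of_notMem_tsupport this]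
    · simp [combKernel, image_eq_zero_of_notMem_tsupport h1]

end CombKernel

section ModelComb

variable {G H : Type*} [AddCommGroup G] [TopologicalSpace G] [MeasurableSpace G]
  [AddCommGroup H] [TopologicalSpace H]

/-- The weighted Dirac comb of a cut and project scheme with a weight function. -/
noncomputable def modelComb (C : CutProjectScheme G H) (φ : H → ℝ) : Measure G :=
  Measure.sum fun l : C.lattice =>
    ENNReal.ofReal (φ (l : G × H).2) • Measure.dirac (l : G × H).1

theorem modelComb_apply (C : CutProjectScheme G H) (φ : H → ℝ) {B : Set G}
    (hB : MeasurableSet B) : modelComb C φ B =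
      ∑' l : C.lattice, ENNReal.ofReal (φ (l : G × H).2) * B.indicator 1 (l : G × H).1 := by
  simp [modelComb, Measure.sum_apply _ hB, Measure.dirac_apply' _ hB]

theorem modelComb_mono (C : CutProjectScheme G H) {φ ψ : H → ℝ} (h : ∀ y, φ y ≤ ψ y) :
    modelComb C φ ≤ modelComb C ψ := by
  rw [Measure.le_iff]
  intro B hB
  rw [modelComb_apply C φ hB, modelComb_apply C ψ hB]
  exact ENNReal.tsum_le_tsum fun l => by gcongr; exact h _

theorem diracComb_apply {X : Type*} [MeasurableSpace X] (Λ : Set X) {B : Set X}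
    (hB : MeasurableSet B) :
    diracComb Λ B = ∑' x : X, Λ.indicator (B.indicator 1) x := by
  rw [diracComb, Measure.sum_apply _ hB, ← tsum_subtype]
  simp [Measure.dirac_apply' _ hB]

theorem modelComb_le_diracComb (C : CutProjectScheme G H) {φ : H → ℝ} {U : Set H} {Λ : Set G}
    (h1 : ∀ y, φ y ≤ 1) (h0 : ∀ y, y ∉ U → φ y = 0) (hΛ : C.oplam U ⊆ Λ) :
    modelComb C φ ≤ diracComb Λ := by
  rw [Measure.le_iff]
  intro B hB
  rw [modelComb_apply C φ hB, diracComb_apply Λ hB]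
  refine le_trans (ENNReal.tsum_le_tsum fun l => ?_)
    (ENNReal.tsum_comp_le_tsum_of_injective C.injective_fst _)
  by_cases hl : (l : G × H).2 ∈ U
  · have : (l : G × H).1 ∈ Λ := hΛ ⟨_, hl, l.2⟩
    rw [Set.indicator_of_mem this]
    exact mul_le_of_le_one_left' (ENNReal.ofReal_le_one.2 (h1 _))
  · simp [h0 _ hl]

theorem diracComb_le_modelComb (C : CutProjectScheme G H) {φ : H → ℝ} {K : Set H} {Λ : Set G}
    (h1 : ∀ y ∈ K, 1 ≤ φ y) (hΛ : Λ ⊆ C.oplam K) : diracComb Λ ≤ modelComb C φ := by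
  rw [Measure.le_iff]
  intro B hB
  rw [modelComb_apply C φ hB, diracComb_apply Λ hB, ← tsum_subtype]
  choose y hy hxy using fun x : Λ => hΛ x.2
  have hinj : Function.Injective fun x : Λ => (⟨((x : G), y x), hxy x⟩ : C.lattice) :=
    fun a b hab => Subtype.ext (congrArg (fun l : C.lattice => (l : G × H).1) hab)
  refine le_trans (ENNReal.tsum_le_tsum fun x => ?_)
    (ENNReal.tsum_comp_le_tsum_of_injective hinj _)
  exact le_mul_of_one_le_left' (ENNReal.one_le_ofReal.2 (h1 _ (hy x)))

variable [BorelSpace G] [T2Space G]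

theorem modelComb_real_singleton (C : CutProjectScheme G H) {φ : H → ℝ} (h0 : ∀ y, 0 ≤ φ y)
    {x : G} {y : H} (hxy : (x, y) ∈ C.lattice) : (modelComb C φ).real {x} = φ y := by
  rw [measureReal_def, modelComb_apply C φ (measurableSet_singleton x),
    tsum_eq_single ⟨(x, y), hxy⟩ fun l hl => ?_]
  · simp [ENNReal.toReal_ofReal (h0 y)]
  · have : (l : G × H).1 ≠ x := fun h => hl (C.injective_fst h)
    simp [this]

theorem modelComb_real_singleton_eq_zero (C : CutProjectScheme G H) (φ : H → ℝ)
    {x : G} (hx : ∀ y, (x, y) ∉ C.lattice) : (modelComb C φ).real {x} = 0 := by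
  rw [measureReal_def, modelComb_apply C φ (measurableSet_singleton x), ENNReal.tsum_eq_zero.2]
  · rfl
  · intro l
    have : (l : G × H).1 ≠ x := fun h => hx (l : G × H).2 (h ▸ l.2)
    simp [this]

/-- An almost period `t` of the `ψ`-comb with tolerance at most `ψ h₀ / 2` lies in the projected
lattice: otherwise it would carry a point of mass above `ψ h₀ / 2` to one of mass zero. Density of
the star coordinates then makes `s = t⋆` an almost period of `ψ` on all of `H`; the peak condition
`hsep` forces `s` close to `0`, where translation hardly changes `φ`. -/
theorem uniformlyContinuousIn_modelComb [IsTopologicalAddGroup H]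
    (C : CutProjectScheme G H) {φ ψ : H → ℝ}
    (hφ : Continuous φ) (hc : HasCompactSupport φ) (h0 : ∀ y, 0 ≤ φ y) (hψ : Continuous ψ)
    (hψ0 : ∀ y, 0 ≤ ψ y) {h₀ : H} (hpos : 0 < ψ h₀)
    (hsep : ∀ V ∈ 𝓝 (0 : H), ∃ δ > 0, ∀ t, |ψ (h₀ + t) - ψ h₀| ≤ δ → t ∈ V) :
    UniformlyContinuousIn (modelComb C φ) (modelComb C ψ) := by
  intro ε hε
  -- Half of `ε`, since the strict inequality has to survive the supremum.
  obtain ⟨δ, hδ, hV⟩ := hsep _ (eventually_forall_norm_sub_lt hφ hc (half_pos hε))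
  have hε' : 0 < min δ (ψ h₀ / 2) := lt_min hδ (half_pos hpos)
  refine ⟨_, hε', fun t ht => ?_⟩
  have hlt : ∀ x, |(modelComb C ψ).real {t + x} - (modelComb C ψ).real {x}| <
      min δ (ψ h₀ / 2) := fun x => by
    rw [← ENNReal.ofReal_lt_ofReal_iff hε']
    exact (le_iSup (fun x => ENNReal.ofReal
      |(modelComb C ψ).real {t + x} - (modelComb C ψ).real {x}|) x).trans_lt ht
  obtain ⟨s, hts⟩ : ∃ s, (t, s) ∈ C.lattice := by
    obtain ⟨x, y, hy, hxy⟩ := C.exists_mem_of_isOpen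
      (isOpen_lt continuous_const hψ : IsOpen {y | ψ h₀ / 2 < ψ y}) ⟨h₀, half_lt_self hpos⟩
    by_contra! hno
    have h1 := hlt x
    rw [modelComb_real_singleton C hψ0 hxy, modelComb_real_singleton_eq_zero C ψ
      (fun z hz => hno (z - y) (by simpa using C.lattice.sub_mem hz hxy)), zero_sub, abs_neg,
      abs_of_nonneg (hψ0 y)] at h1
    exact absurd (h1.trans_le (min_le_right _ _)) (not_lt.2 (le_of_lt hy))
  have hcl : ∀ y, |ψ (y + s) - ψ y| ≤ min δ (ψ h₀ / 2) := by
    have hclosed : IsClosed {y | |ψ (y + s) - ψ y| ≤ min δ (ψ h₀ / 2)} :=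
      isClosed_le (by fun_prop) continuous_const
    intro y
    refine closure_minimal ?_ hclosed (C.dense_snd y)
    rintro _ ⟨⟨x, y⟩, hxy, rfl⟩
    have h1 := (hlt x).le
    have h2 : (t + x, y + s) ∈ C.lattice := by
      simpa [add_comm] using C.lattice.add_mem hts hxy
    rwa [modelComb_real_singleton C hψ0 hxy, modelComb_real_singleton C hψ0 h2] at h1
  have hs := hV s ((hcl h₀).trans (min_le_left _ _))
  refine lt_of_le_of_lt (iSup_le fun x => ENNReal.ofReal_le_ofReal ?_)
    ((ENNReal.ofReal_lt_ofReal_iff hε).2 (half_lt_self hε))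
  by_cases hx : ∃ y, (x, y) ∈ C.lattice
  · obtain ⟨y, hxy⟩ := hx
    have h2 : (t + x, y + s) ∈ C.lattice := by
      simpa [add_comm] using C.lattice.add_mem hts hxy
    rw [modelComb_real_singleton C h0 hxy, modelComb_real_singleton C h0 h2]
    exact (hs y).le
  · push Not at hx
    rw [modelComb_real_singleton_eq_zero C φ hx, modelComb_real_singleton_eq_zero C φ
      fun z hz => hx (z - s) (by simpa using C.lattice.sub_mem hz hts)]
    simpa using (half_pos hε).le

variable [IsTopologicalAddGroup G] [IsTopologicalAddGroup H] [T2Space H]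

theorem isFiniteMeasureOnCompacts_modelComb (C : CutProjectScheme G H) {φ : H → ℝ}
    (hc : HasCompactSupport φ) : IsFiniteMeasureOnCompacts (modelComb C φ) := by
  refine ⟨fun K hK => ?_⟩
  rw [modelComb_apply C φ hK.isClosed.measurableSet]
  have hdisc := C.isLattice.1
  have hfin := finite_coe_mem_of_isCompact C.lattice (hK.prod hc.isCompact)
  rw [tsum_eq_sum (s := hfin.toFinset) fun l hl => ?_]
  · refine ENNReal.sum_lt_top.2 fun l _ => ENNReal.mul_lt_top ENNReal.ofReal_lt_top ?_
    by_cases h : (l : G × H).1 ∈ K <;> simp [h]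
  · by_cases h1 : (l : G × H).1 ∈ K
    · have : (l : G × H).2 ∉ tsupport φ := fun h2 => hl (hfin.mem_toFinset.2 ⟨h1, h2⟩)
      simp [image_eq_zero_of_notMem_tsupport this]
    · simp [h1]

theorem integral_modelComb (C : CutProjectScheme G H) {φ : H → ℝ} (hc : HasCompactSupport φ)
    (h0 : ∀ y, 0 ≤ φ y) {f : G → ℂ} (hf : Continuous f) (hfc : HasCompactSupport f) :
    ∫ y, f y ∂(modelComb C φ) = ∑' l : C.lattice, (φ (l : G × H).2 : ℂ) * f (l : G × H).1 := by
  have hfin := isFiniteMeasureOnCompacts_modelComb C hc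
  have hint : Integrable f (modelComb C φ) := hf.integrable_of_hasCompactSupport hfc
  rw [modelComb] at hint ⊢
  rw [integral_sum_measure hint]
  refine tsum_congr fun l => ?_
  rw [integral_smul_measure, integral_dirac, ENNReal.toReal_ofReal (h0 _), Complex.real_smul]

/-- Convolution runs over `x - l`, periodization over `l + x`; the substitution `l ↦ -l` reconciles
them and accounts for the sign in `combKernel`. -/
theorem integral_modelComb_eq_periodization (C : CutProjectScheme G H) {φ : H → ℝ}
    (hc : HasCompactSupport φ) (h0 : ∀ y, 0 ≤ φ y) {f : G → ℂ} (hf : Continuous f)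
    (hfc : HasCompactSupport f) (x : G) : ∫ y, f (x - y) ∂(modelComb C φ) =
      periodization C.lattice (combKernel φ f) (orbitHom C.lattice x) := by
  have hdisc : DiscreteTopology C.lattice := C.isLattice.1
  have hterm : ∀ l : C.lattice, (φ (l : G × H).2 : ℂ) * f (x - (l : G × H).1) =
      combKernel φ f (((-l : C.lattice) : G × H) + (x, 0)) := fun l => by
    simp [combKernel, sub_eq_add_neg, add_comm]
  have hsupp : (Function.support fun l : C.lattice =>
      (φ (l : G × H).2 : ℂ) * f (x - (l : G × H).1)).Finite := by
    simp only [hterm]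
    exact (finite_support_add C.lattice (hasCompactSupport_combKernel hc hfc) (x, 0)).preimage
      neg_injective.injOn
  rw [integral_modelComb C hc h0 (f := fun y => f (x - y)) (by fun_prop)
    (hfc.comp_homeomorph (Homeomorph.subLeft x)), tsum_eq_finsum hsupp]
  simp only [hterm]
  rw [show orbitHom C.lattice x = QuotientAddGroup.mk ((x, 0) : G × H) from rfl,
    periodization_mk]
  exact finsum_comp_equiv (Equiv.neg C.lattice)
    (f := fun l : C.lattice => combKernel φ f ((l : G × H) + (x, 0)))

variable [LocallyCompactSpace G]

theorem modelComb_compl_eq_zero (C : CutProjectScheme G H) {φ : H → ℝ}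
    (hc : HasCompactSupport φ) : modelComb C φ (C.oplam (tsupport φ))ᶜ = 0 := by
  rw [modelComb_apply C φ (C.locFinite_oplam hc.isCompact).isClosed.measurableSet.compl,
    ENNReal.tsum_eq_zero]
  intro l
  by_cases hl : (l : G × H).2 ∈ tsupport φ
  · have : (l : G × H).1 ∈ C.oplam (tsupport φ) := ⟨_, hl, l.2⟩
    simp [this]
  · simp [image_eq_zero_of_notMem_tsupport hl]

theorem isWeightedModelComb_modelComb (C : CutProjectScheme G H) {φ : H → ℝ}
    (hc : HasCompactSupport φ) (h0 : ∀ y, 0 ≤ φ y) : IsWeightedModelComb C φ (modelComb C φ) where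
  finiteOnCompacts := isFiniteMeasureOnCompacts_modelComb C hc
  carrier := ⟨_, C.locFinite_oplam hc.isCompact, modelComb_compl_eq_zero C hc⟩
  apply_lattice _ _ := modelComb_real_singleton C h0
  apply_other _ := modelComb_real_singleton_eq_zero C φ

/-- Outer regularity: the carrier is locally finite, so deleting its points outside `A` from the
whole space leaves an open set of no larger mass than `A`. Inner regularity: the mass of an open set
is a supremum of finite partial sums, each carried by a finite set. -/
theorem regular_modelComb (C : CutProjectScheme G H) {φ : H → ℝ} (hc : HasCompactSupport φ) :
    (modelComb C φ).Regular where
  lt_top_of_isCompact := (isFiniteMeasureOnCompacts_modelComb C hc).lt_top_of_isCompact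
  outerRegular := fun A _ r hr => by
    have hS := C.locFinite_oplam hc.isCompact
    refine ⟨(C.oplam (tsupport φ) \ A)ᶜ, fun x hx h => h.2 hx,
      (hS.mono Set.sdiff_subset).isClosed.isOpen_compl, lt_of_le_of_lt ?_ hr⟩
    refine (measure_mono (t := A ∪ (C.oplam (tsupport φ))ᶜ) fun x hx => ?_).trans
      ((measure_union_le _ _).trans (by rw [modelComb_compl_eq_zero C hc, add_zero]))
    by_contra h
    rw [Set.mem_union, not_or, Set.notMem_compl_iff] at h
    exact hx ⟨h.2, h.1⟩
  innerRegular := fun U hU r hr => by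
    classical
    rw [modelComb_apply C φ hU.measurableSet, ENNReal.tsum_eq_iSup_sum] at hr
    obtain ⟨s, hs⟩ := lt_iSup_iff.1 hr
    have hfin : ((fun l : C.lattice => (l : G × H).1) '' s ∩ U).Finite :=
      (s.finite_toSet.image _).subset Set.inter_subset_left
    refine ⟨_, Set.inter_subset_right, hfin.isCompact, hs.trans_le ?_⟩
    rw [modelComb_apply C φ hfin.measurableSet]
    refine le_trans (Finset.sum_le_sum fun l hl => ?_) (ENNReal.sum_le_tsum s)
    refine mul_le_mul' le_rfl ?_
    by_cases hlU : (l : G × H).1 ∈ U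
    · have : (l : G × H).1 ∈ (fun l : C.lattice => (l : G × H).1) '' s ∩ U := ⟨⟨l, hl, rfl⟩, hlU⟩
      simp only [Set.indicator_of_mem this, Set.indicator_of_mem hlU, le_refl]
    · simp [hlU]

/-- The support contains the projection set of the open set `φ ≠ 0` and lies in that of the compact
set `tsupport φ`, whose threefold differences again have a compact window. -/
theorem isMeyer_support_modelComb (C : CutProjectScheme G H) {φ : H → ℝ} (hφ : Continuous φ)
    (hc : HasCompactSupport φ) (h0 : ∀ y, 0 ≤ φ y) (hne : ∃ y, φ y ≠ 0) :
    IsMeyer (modelComb C φ).support := by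
  constructor
  · refine (C.relativelyDense_oplam (hφ.isOpen_support) hne).mono ?_
    rintro x ⟨y, hy, hxy⟩
    refine mem_support_of_measureReal_singleton_ne_zero ?_
    rwa [modelComb_real_singleton C h0 hxy]
  · have hsub : (modelComb C φ).support ⊆ C.oplam (tsupport φ) :=
      Measure.support_subset_of_isClosed (C.locFinite_oplam hc.isCompact).isClosed
        (modelComb_compl_eq_zero C hc)
    refine (C.locFinite_oplam (isCompact_sub (isCompact_sub hc.isCompact hc.isCompact)
      hc.isCompact)).mono ?_
    refine (Set.sub_subset_sub (Set.sub_subset_sub hsub hsub) hsub).trans ?_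
    exact (Set.sub_subset_sub_right (C.oplam_sub_subset _ _)).trans (C.oplam_sub_subset _ _)

/-- The convolution is a continuous function on the compact torus, restricted to the dense orbit. -/
theorem isStronglyAlmostPeriodic_modelComb [LocallyCompactSpace H] (C : CutProjectScheme G H)
    {φ : H → ℝ} (hφ : Continuous φ) (hc : HasCompactSupport φ) (h0 : ∀ y, 0 ≤ φ y) :
    IsStronglyAlmostPeriodic (modelComb C φ) := by
  intro f hf hfc
  have hdisc : DiscreteTopology C.lattice := C.isLattice.1
  have hcomp : CompactSpace ((G × H) ⧸ C.lattice) := compactSpace_quotient C.isLattice.2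
  have hcont := continuous_periodization C.lattice (continuous_combKernel hφ hf)
    (hasCompactSupport_combKernel hc hfc)
  have h := isAlmostPeriodic_comp_of_denseRange (continuous_orbitHom C.lattice)
    (denseRange_orbitHom C.dense_snd) hcont
  rwa [← funext (integral_modelComb_eq_periodization C hc h0 hf hfc)] at h

end ModelComb

/-! ### Continuous approximations of the window. -/

section WindowApproximation

variable {H : Type*} [AddCommGroup H] [TopologicalSpace H] [IsTopologicalAddGroup H]
  [TopologicalSpace.MetrizableSpace H]

/-- A non-empty open set of a metrisable group supports a continuous function with a unique
maximum, whose approximate periods are small. -/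
theorem exists_peak_function {U : Set H} (hU : IsOpen U) {h₀ : H} (h₀U : h₀ ∈ U) :
    ∃ ψ : H → ℝ, Continuous ψ ∧ (∀ y, 0 ≤ ψ y) ∧ (∀ y, ψ y ≤ 1) ∧ (∀ y, y ∉ U → ψ y = 0) ∧
      0 < ψ h₀ ∧ ∀ V ∈ 𝓝 (0 : H), ∃ δ > 0, ∀ t, |ψ (h₀ + t) - ψ h₀| ≤ δ → t ∈ V := by
  let _ := TopologicalSpace.metrizableSpaceMetric H
  obtain ⟨r, hr, hrU⟩ := Metric.isOpen_iff.1 hU h₀ h₀U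
  have hρ : 0 < min r 1 := lt_min hr one_pos
  -- A tent over `h₀`: its drop from the peak measures the distance to `h₀`, and the height `min r
  -- 1` keeps it inside `U` and below `1`.
  refine ⟨fun y => max 0 (min r 1 - dist y h₀), by fun_prop, fun y => le_max_left _ _,
    fun y => max_le zero_le_one ?_, fun y hy => max_eq_left ?_, by simp [hr], fun V hV => ?_⟩
  · linarith [min_le_right r 1, dist_nonneg (x := y) (y := h₀)]
  · have : r ≤ dist y h₀ := not_lt.1 fun h => hy (hrU h)
    linarith [min_le_left r 1]
  · have hV' : (fun y => y - h₀) ⁻¹' V ∈ 𝓝 h₀ :=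
      (by fun_prop : Continuous fun y : H => y - h₀).continuousAt.preimage_mem_nhds (by simpa)
    obtain ⟨η, hη, hηV⟩ := Metric.mem_nhds_iff.1 hV'
    -- Below the height of the tent, so that the branch truncated to `0` is excluded, and below `η`.
    refine ⟨min η (min r 1) / 2, half_pos (lt_min hη hρ), fun t ht => ?_⟩
    have h1 : min η (min r 1) / 2 < min r 1 := by
      have := min_le_right η (min r 1)
      linarith
    have h2 : min η (min r 1) / 2 < η := by
      have := min_le_left η (min r 1)
      linarith
    simp only [dist_self, sub_zero, max_eq_right hρ.le] at ht
    have h3 := abs_le.1 ht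
    have h4 : dist (h₀ + t) h₀ < η := by
      rcases le_total 0 (min r 1 - dist (h₀ + t) h₀) with h | h
      · rw [max_eq_right h] at h3
        linarith [h3.1]
      · rw [max_eq_left h] at h3
        linarith [h3.1]
    simpa using hηV h4

/-- A compact set is the limit of a decreasing sequence of compactly supported continuous
functions. -/
theorem exists_antitone_approx {H : Type*} [TopologicalSpace H] [LocallyCompactSpace H]
    [TopologicalSpace.MetrizableSpace H] {K : Set H} (hK : IsCompact K) :
    ∃ φ : ℕ → H → ℝ, (∀ n, Continuous (φ n)) ∧ (∀ n, HasCompactSupport (φ n)) ∧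
      (∀ n y, 0 ≤ φ n y) ∧ (∀ n, ∀ y ∈ K, 1 ≤ φ n y) ∧ (∀ y, Antitone fun n => φ n y) ∧
      ∀ y, Tendsto (fun n => φ n y) atTop (𝓝 (K.indicator 1 y)) := by
  let _ := TopologicalSpace.metrizableSpaceMetric H
  obtain ⟨χ, hχ1, -, hχc, hχ⟩ := exists_continuous_one_zero_of_isCompact hK
    isClosed_empty (Set.disjoint_empty _)
  have hδ : ∀ n : ℕ, 0 < 1 / ((n : ℝ) + 1) := fun n => by positivity
  refine ⟨fun n y => thickenedIndicator (hδ n) K y * χ y, fun n => ?_, fun n => hχc.mul_left,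
    fun n y => mul_nonneg (NNReal.coe_nonneg _) (hχ y).1, fun n y hy => ?_, fun y m n hmn => ?_,
    fun y => ?_⟩
  · have := (thickenedIndicator (hδ n) K).continuous
    fun_prop
  · simp only [thickenedIndicator_one (hδ n) K hy, hχ1 hy]
    simp
  · refine mul_le_mul_of_nonneg_right (NNReal.coe_le_coe.2 ?_) (hχ y).1
    exact thickenedIndicator_mono (hδ n) (hδ m) (by gcongr) K y
  · have h := tendsto_pi_nhds.1 (thickenedIndicator_tendsto_indicator_closure hδ
      tendsto_one_div_add_atTop_nhds_zero_nat K) y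
    have h2 := ((NNReal.continuous_coe.tendsto _).comp h).mul_const (χ y)
    refine Eq.subst (motive := fun z => Tendsto _ atTop (𝓝 z)) ?_ h2
    rw [hK.isClosed.closure_eq]
    by_cases hy : y ∈ K
    · simp [hy, hχ1 hy]
    · simp [hy]

/-- A relatively compact open set is the limit of an increasing sequence of continuous functions
that starts with a peak function. -/
theorem exists_monotone_approx {U : Set H} (hU : IsOpen U) (hne : U.Nonempty) :
    ∃ ψ : ℕ → H → ℝ, (∀ n, Continuous (ψ n)) ∧ (∀ n y, 0 ≤ ψ n y) ∧ (∀ n y, ψ n y ≤ 1) ∧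
      (∀ n, ∀ y, y ∉ U → ψ n y = 0) ∧ (∀ y, Monotone fun n => ψ n y) ∧
      (∀ y, Tendsto (fun n => ψ n y) atTop (𝓝 (U.indicator 1 y))) ∧
      ∃ h₀, 0 < ψ 0 h₀ ∧
        ∀ V ∈ 𝓝 (0 : H), ∃ δ > 0, ∀ t, |ψ 0 (h₀ + t) - ψ 0 h₀| ≤ δ → t ∈ V := by
  obtain ⟨h₀, hh₀⟩ := hne
  obtain ⟨p, hpc, hp0, hp1, hpU, hpos, hsep⟩ := exists_peak_function hU hh₀
  let _ := TopologicalSpace.metrizableSpaceMetric H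
  have hδ : ∀ n : ℕ, 0 < 1 / ((n : ℝ) + 1) := fun n => by positivity
  -- The factor `1 - 1 / (n + 1)` tends to `1` but vanishes at `n = 0`, so the maximum of `p` and `q
  -- 0` is exactly the peak function `p`.
  set q : ℕ → H → ℝ := fun n y =>
    (1 - 1 / ((n : ℝ) + 1)) * (1 - thickenedIndicator (hδ n) Uᶜ y) with hq
  have ha : ∀ n : ℕ, 0 ≤ 1 - 1 / ((n : ℝ) + 1) := fun n => by
    rw [sub_nonneg, div_le_one (by positivity)]
    linarith [n.cast_nonneg (α := ℝ)]
  have hb : ∀ n y, 0 ≤ 1 - (thickenedIndicator (hδ n) Uᶜ y : ℝ) := fun n y =>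
    sub_nonneg.2 (NNReal.coe_le_one.2 (thickenedIndicator_le_one (hδ n) _ y))
  have hq0 : ∀ y, max (p y) (q 0 y) = p y := fun y => max_eq_left (by simp [hq, hp0])
  refine ⟨fun n y => max (p y) (q n y), fun n => ?_, fun n y => le_max_of_le_left (hp0 y),
    fun n y => max_le (hp1 y) ?_, fun n y hy => ?_, fun y m n hmn => max_le_max le_rfl ?_,
    fun y => ?_, h₀, ?_, ?_⟩
  · have := (thickenedIndicator (hδ n) Uᶜ).continuous
    fun_prop
  · exact mul_le_one₀ (sub_le_self _ (hδ n).le) (hb n y) (sub_le_self _ (NNReal.coe_nonneg _))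
  · simp only [hpU y hy, hq, thickenedIndicator_one (hδ n) Uᶜ (Set.mem_compl hy)]
    simp
  · refine mul_le_mul (by gcongr) (sub_le_sub_left (NNReal.coe_le_coe.2 ?_) _) (hb m y) (ha n)
    exact thickenedIndicator_mono (hδ n) (hδ m) (by gcongr) Uᶜ y
  · have h := tendsto_pi_nhds.1 (thickenedIndicator_tendsto_indicator_closure hδ
      tendsto_one_div_add_atTop_nhds_zero_nat Uᶜ) y
    have h2 := (((NNReal.continuous_coe.tendsto _).comp h).const_sub 1)
    have h3 : Tendsto (fun n : ℕ => 1 - 1 / ((n : ℝ) + 1)) atTop (𝓝 1) := by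
      simpa using tendsto_one_div_add_atTop_nhds_zero_nat.const_sub (1 : ℝ)
    refine Eq.subst (motive := fun z => Tendsto _ atTop (𝓝 z)) ?_
      ((tendsto_const_nhds (x := p y)).max (h3.mul h2))
    rw [hU.isClosed_compl.closure_eq]
    by_cases hy : y ∈ U
    · simp [hy, hp1]
    · simp [hy, hpU]
  · simpa only [hq0] using hpos
  · simpa only [hq0] using hsep

end WindowApproximation

/-! ### From a window to sandwiching combs. -/

/-- The Dirac comb of a regular inter model set is sandwiched between model combs with small
difference of means. -/
theorem IsRegularInterModelSetMetrisable.exists_sandwich {G : Type u} [AddCommGroup G]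
    [TopologicalSpace G] [IsTopologicalAddGroup G] [T2Space G] [LocallyCompactSpace G]
    [MeasurableSpace G] [BorelSpace G] (θ : Measure G) [θ.IsAddHaarMeasure] {Λ : Set G}
    (hΛ : IsRegularInterModelSetMetrisable Λ) :
    ∃ ω ν : ℕ → Measure G,
      (∀ n, (ω n).Regular) ∧ (∀ n, (ν n).Regular) ∧
      Monotone ω ∧ Antitone ν ∧
      (∀ n, ω n ≤ diracComb Λ) ∧ (∀ n, diracComb Λ ≤ ν n) ∧
      (∀ n, IsStronglyAlmostPeriodic (ω n) ∧ IsMeyer (ω n).support) ∧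
      (∀ n, IsStronglyAlmostPeriodic (ν n) ∧ IsMeyer (ν n).support) ∧
      (∃ m : ℕ → ℝ, (∀ n, HasMeanSub θ (ν n) (ω n) (m n)) ∧ Tendsto m atTop (𝓝 0)) ∧
      (∀ n, UniformlyContinuousIn (ν n) (ω 0)) ∧
      (∀ n, UniformlyContinuousIn (ω n) (ω 0)) := by
  obtain ⟨H, _, _, _, _, _, _, _, C, W, hWc, hWi, hWf, hΛi, hΛc⟩ := hΛ
  obtain ⟨φ, hφ, hφc, hφ0, hφ1, hφa, hφl⟩ := exists_antitone_approx hWc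
  obtain ⟨ψ, hψ, hψ0, hψ1, hψU, hψm, hψl, h₀, hpos, hsep⟩ :=
    exists_monotone_approx isOpen_interior hWi
  have hUK : interior W ⊆ closure W := interior_subset.trans subset_closure
  have hψc : ∀ n, HasCompactSupport (ψ n) := fun n =>
    HasCompactSupport.intro hWc fun y hy => hψU n y fun h => hy (hUK h)
  have hψne : ∀ n, ∃ y, ψ n y ≠ 0 := fun n =>
    ⟨h₀, (hpos.trans_le (hψm h₀ (Nat.zero_le n))).ne'⟩
  have hφne : ∀ n, ∃ y, φ n y ≠ 0 := fun n => by
    obtain ⟨y, hy⟩ := hWi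
    exact ⟨y, (one_pos.trans_le (hφ1 n y (hUK hy))).ne'⟩
  set μ : Measure H := Measure.addHaar with hμ
  obtain ⟨d, -, hd⟩ := exists_density θ C μ
  refine ⟨fun n => modelComb C (ψ n), fun n => modelComb C (φ n),
    fun n => regular_modelComb C (hψc n), fun n => regular_modelComb C (hφc n),
    fun m n hmn => modelComb_mono C fun y => hψm y hmn,
    fun m n hmn => modelComb_mono C fun y => hφa y hmn,
    fun n => modelComb_le_diracComb C (hψ1 n) (hψU n) hΛi,
    fun n => diracComb_le_modelComb C (hφ1 n) hΛc,
    fun n => ⟨isStronglyAlmostPeriodic_modelComb C (hψ n) (hψc n) (hψ0 n),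
      isMeyer_support_modelComb C (hψ n) (hψc n) (hψ0 n) (hψne n)⟩,
    fun n => ⟨isStronglyAlmostPeriodic_modelComb C (hφ n) (hφc n) (hφ0 n),
      isMeyer_support_modelComb C (hφ n) (hφc n) (hφ0 n) (hφne n)⟩,
    ⟨fun n => d * ∫ h, φ n h ∂μ - d * ∫ h, ψ n h ∂μ, fun n A hA x => ?_, ?_⟩,
    fun n => uniformlyContinuousIn_modelComb C (hφ n) (hφc n) (hφ0 n) (hψ 0) (hψ0 0) hpos hsep,
    fun n => uniformlyContinuousIn_modelComb C (hψ n) (hψc n) (hψ0 n) (hψ 0) (hψ0 0) hpos hsep⟩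
  · have h1 := hd (φ n) (hφ n) (hφc n) _ (isWeightedModelComb_modelComb C (hφc n) (hφ0 n)) _
      (hA.vadd x)
    have h2 := hd (ψ n) (hψ n) (hψc n) _ (isWeightedModelComb_modelComb C (hψc n) (hψ0 n)) _
      (hA.vadd x)
    have h3 : ∀ k, θ.real (x +ᵥ A k) = θ.real (A k) := fun k => by
      simp [measureReal_def, measure_vadd]
    simpa only [h3, sub_div] using h1.sub h2
  -- The weight `φ 0` dominates both sequences; the limits differ by the measure of the frontier.
  · have hbound : Integrable (φ 0) μ := (hφ 0).integrable_of_hasCompactSupport (hφc 0)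
    have h1 := tendsto_integral_of_dominated_convergence (μ := μ) (F := φ) (φ 0)
      (fun n => (hφ n).aestronglyMeasurable) hbound
      (fun n => ae_of_all _ fun y => by
        rw [Real.norm_of_nonneg (hφ0 n y)]
        exact hφa y (Nat.zero_le n)) (ae_of_all _ hφl)
    have h2 := tendsto_integral_of_dominated_convergence (μ := μ) (F := ψ) (φ 0)
      (fun n => (hψ n).aestronglyMeasurable) hbound
      (fun n => ae_of_all _ fun y => by
        rw [Real.norm_of_nonneg (hψ0 n y)]
        by_cases hy : y ∈ interior W
        · exact (hψ1 n y).trans (hφ1 0 y (hUK hy))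
        · exact (hψU n y hy).trans_le (hφ0 0 y)) (ae_of_all _ hψl)
    have h3 : ∫ h, (closure W).indicator (1 : H → ℝ) h ∂μ -
        ∫ h, (interior W).indicator (1 : H → ℝ) h ∂μ = 0 := by
      rw [integral_indicator_one isClosed_closure.measurableSet,
        integral_indicator_one isOpen_interior.measurableSet,
        ← measureReal_sdiff hUK isOpen_interior.measurableSet hWc.measure_lt_top.ne]
      exact congrArg ENNReal.toReal hWf
    have h4 := (h1.const_mul d).sub (h2.const_mul d)
    rwa [← mul_sub, h3, mul_zero] at h4

/-! ### Almost periods of point masses. -/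

section AlmostPeriods

/-- The integral of a function that sees at most one point of a carrier of the measure. -/
theorem integral_eq_of_forall_mem_support {G : Type*} [TopologicalSpace G] [T2Space G]
    [MeasurableSpace G] [BorelSpace G] {ω : Measure G} [ω.Regular] {g : G → ℂ} {y₀ : G}
    (hg : ∀ y ∈ ω.support, g y ≠ 0 → y = y₀) : ∫ y, g y ∂ω = ω.real {y₀} * g y₀ := by
  have h : g =ᵐ[ω] ({y₀} : Set G).indicator g := by
    filter_upwards [measure_eq_zero_iff_ae_notMem.1 (measure_compl_support_eq_zero ω)] with y hy
    by_cases hy0 : y = y₀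
    · simp [hy0]
    · rw [Set.indicator_of_notMem (by simpa using hy0)]
      by_contra hgy
      exact hy0 (hg y (by simpa using hy) hgy)
  rw [integral_congr_ae h, integral_indicator (measurableSet_singleton _), integral_singleton,
    Complex.real_smul]

variable {G : Type*} [AddCommGroup G] [TopologicalSpace G] [IsTopologicalAddGroup G] [T2Space G]
  [LocallyCompactSpace G] [MeasurableSpace G] [BorelSpace G]

/-- The point masses of a strongly almost periodic measure with Meyer support have relatively dense
almost periods. -/
theorem relativelyDense_almostPeriods {ω : Measure G} [ω.Regular]
    (hap : IsStronglyAlmostPeriodic ω) (hM : IsMeyer ω.support) {ε : ℝ} (hε : 0 < ε) :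
    RelativelyDense {t | ∀ z, |ω.real {t + z} - ω.real {z}| ≤ ε} := by
  set S := ω.support with hS
  set c : G → ℝ := fun x => ω.real {x} with hc
  have hc0 : ∀ x, 0 ≤ c x := fun x => measureReal_nonneg
  have hcS : ∀ x, x ∉ S → c x = 0 := fun x hx =>
    by_contra fun h => hx (mem_support_of_measureReal_singleton_ne_zero h)
  obtain ⟨x₀, hx₀⟩ := hM.1.nonempty
  have hcx₀ : 0 < c x₀ := measureReal_singleton_pos hM.locFinite hx₀
  -- The symmetric neighbourhood `V` is so small that two of its elements whose sum is a fourfold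
  -- difference cancel. At the evaluation points used below, a test function supported in `V` then
  -- sees at most one point of `S`.
  have hiso := hM.locFinite_sub_sub_sub.eventually_eq 0
  obtain ⟨V₁, hV₁o, hV₁0, hV₁⟩ := exists_open_nhds_zero_half hiso
  set V : Set G := V₁ ∩ -V₁ with hVdef
  have hVo : IsOpen V := hV₁o.inter hV₁o.neg
  have hV0 : (0 : G) ∈ V := ⟨hV₁0, by simpa using hV₁0⟩
  have hVneg : ∀ v ∈ V, -v ∈ V := fun v hv => ⟨hv.2, by simpa using hv.1⟩
  have hVadd : ∀ v ∈ V, ∀ w ∈ V, v + w ∈ (S - S) - (S - S) → v + w = 0 := fun v hv w hw =>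
    hV₁ v hv.1 w hw.1
  obtain ⟨f, hf1, hf0, hfc, hf⟩ := exists_continuous_one_zero_of_isCompact
    (isCompact_singleton (x := (0 : G))) hVo.isClosed_compl (by simpa using hV0)
  have hfV : ∀ u, f u ≠ 0 → u ∈ V := fun u hu => by_contra fun h => hu (hf0 h)
  have hf00 : f 0 = 1 := hf1 rfl
  set F : G → ℂ := fun x => ∫ y, (f (x - y) : ℂ) ∂ω with hF
  obtain ⟨-, hper⟩ := hap (fun x => (f x : ℂ)) (by fun_prop)
    (hfc.comp_left (g := fun r : ℝ => (r : ℂ)) Complex.ofReal_zero)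
  -- The bound `c x₀` prevents `F (x₀ + t)` from vanishing, which supplies a point `y₁` of `S` near
  -- `x₀ + t`.
  obtain ⟨K, hK, hTK⟩ := hper (min ε (c x₀)) (lt_min hε hcx₀)
  obtain ⟨K', hK', hVK'⟩ : ∃ K' : Set G, IsCompact K' ∧ ∀ u, f u ≠ 0 → u ∈ K' :=
    ⟨tsupport f, hfc.isCompact, fun u hu => subset_tsupport f hu⟩
  have hsingle : ∀ u y₀, (∀ y ∈ S, u - y ∈ V → y = y₀) → F u = (c y₀ * f (u - y₀) : ℝ) := by
    intro u y₀ h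
    rw [hF]
    simp only
    rw [integral_eq_of_forall_mem_support (y₀ := y₀) fun y hy hne =>
      h y hy (hfV _ fun h0 => hne (by simp [h0]))]
    push_cast
    rfl
  -- A period of `F` is moved by a small `v` to the exact difference `y₁ - x₀` of two points of `S`;
  -- this corrected shift is an almost period of the masses.
  have key : ∀ t, (∀ x, ‖F (x + t) - F x‖ < min ε (c x₀)) →
      ∃ v, f v ≠ 0 ∧ ∀ z, |c (t - v + z) - c z| ≤ ε := by
    intro t ht
    have hFx₀ : F x₀ = (c x₀ : ℝ) := by
      rw [hsingle x₀ x₀ fun y hy hyV => ?_, sub_self, hf00, mul_one]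
      have := hVadd _ hyV 0 hV0 (by
        rw [add_zero]
        exact ⟨x₀ - y, ⟨x₀, hx₀, y, hy, rfl⟩, 0, ⟨y, hy, y, hy, by simp⟩, by simp⟩)
      rw [add_zero, sub_eq_zero] at this
      exact this.symm
    obtain ⟨y₁, hy₁, hv⟩ : ∃ y ∈ S, f (x₀ + t - y) ≠ 0 := by
      by_contra! hno
      have h0 : F (x₀ + t) = 0 := by
        rw [hF]
        simp only
        rw [integral_eq_of_forall_mem_support (y₀ := x₀) fun y hy hne =>
          absurd (by simp [hno y hy]) hne, hno x₀ hx₀, Complex.ofReal_zero, mul_zero]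
      have h1 := (ht x₀).trans_le (min_le_right _ _)
      rw [h0, hFx₀, zero_sub, norm_neg, Complex.norm_real, Real.norm_of_nonneg (hc0 _)] at h1
      exact lt_irrefl _ h1
    refine ⟨x₀ + t - y₁, hv, fun z => ?_⟩
    set v := x₀ + t - y₁ with hvdef
    have hvV : v ∈ V := hfV _ hv
    have htv : t - v = y₁ - x₀ := by rw [hvdef]; abel
    rw [htv]
    by_cases hz : z ∈ S ∨ y₁ - x₀ + z ∈ S
    swap
    · rw [not_or] at hz
      simpa [hcS _ hz.1, hcS _ hz.2] using hε.le
    have hD1 : ∀ y ∈ S, z - y ∈ (S - S) - (S - S) := by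
      intro y hy
      rcases hz with hz | hz
      · exact ⟨z - y, ⟨z, hz, y, hy, rfl⟩, 0, ⟨y, hy, y, hy, by simp⟩, by simp⟩
      · exact ⟨y₁ - x₀ + z - y₁, ⟨_, hz, y₁, hy₁, rfl⟩, y - x₀, ⟨y, hy, x₀, hx₀, rfl⟩, by
          simp only; abel⟩
    have hD2 : ∀ y ∈ S, y₁ - x₀ + z - y ∈ (S - S) - (S - S) := by
      intro y hy
      rcases hz with hz | hz
      · exact ⟨z - x₀, ⟨z, hz, x₀, hx₀, rfl⟩, y - y₁, ⟨y, hy, y₁, hy₁, rfl⟩, by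
          simp only; abel⟩
      · exact ⟨y₁ - x₀ + z - y, ⟨_, hz, y, hy, rfl⟩, 0, ⟨y, hy, y, hy, by simp⟩, by simp⟩
    have e1 : F z = (c z : ℝ) := by
      rw [hsingle z z fun y hy hyV => ?_, sub_self, hf00, mul_one]
      have := hVadd _ hyV 0 hV0 (by rw [add_zero]; exact hD1 y hy)
      rw [add_zero, sub_eq_zero] at this
      exact this.symm
    have e2 : F (z + t) = (c (y₁ - x₀ + z) * f v : ℝ) := by
      rw [hsingle (z + t) (y₁ - x₀ + z) fun y hy hyV => ?_]
      · congr 3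
        rw [hvdef]; abel
      · have e : z + t - y + -v = y₁ - x₀ + z - y := by rw [hvdef]; abel
        have := hVadd _ hyV _ (hVneg v hvV) (by rw [e]; exact hD2 y hy)
        rw [e, sub_eq_zero] at this
        exact this.symm
    have e3 : F (z - v) = (c z * f (-v) : ℝ) := by
      rw [hsingle (z - v) z fun y hy hyV => ?_]
      · congr 3
        abel
      · have e : z - v - y + v = z - y := by abel
        have := hVadd _ hyV _ hvV (by rw [e]; exact hD1 y hy)
        rw [e, sub_eq_zero] at this
        exact this.symm
    have e4 : F (z - v + t) = (c (y₁ - x₀ + z) : ℝ) := by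
      have e : z - v + t = y₁ - x₀ + z := by rw [hvdef]; abel
      rw [e, hsingle _ (y₁ - x₀ + z) fun y hy hyV => ?_, sub_self, hf00, mul_one]
      have := hVadd _ hyV 0 hV0 (by rw [add_zero]; exact hD2 y hy)
      rw [add_zero, sub_eq_zero] at this
      exact this.symm
    -- Evaluation at `z` damps only the shifted mass, by `f v`, and evaluation at `z - v` only the
    -- original one, by `f (-v)`. As these factors are at most `1`, each evaluation gives one of the
    -- two inequalities.
    have i1 := (ht z).trans_le (min_le_left _ _)
    have i2 := (ht (z - v)).trans_le (min_le_left _ _)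
    rw [e1, e2, ← Complex.ofReal_sub, Complex.norm_real, Real.norm_eq_abs, abs_lt] at i1
    rw [e3, e4, ← Complex.ofReal_sub, Complex.norm_real, Real.norm_eq_abs, abs_lt] at i2
    have j1 : c (y₁ - x₀ + z) * f v ≤ c (y₁ - x₀ + z) := mul_le_of_le_one_right (hc0 _) (hf _).2
    have j2 : c z * f (-v) ≤ c z := mul_le_of_le_one_right (hc0 _) (hf _).2
    exact abs_le.2 ⟨by linarith [i1.1], by linarith [i2.2]⟩
  refine ⟨K' + K, hK'.add hK, Set.eq_univ_of_forall fun x => ?_⟩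
  obtain ⟨t, ht, k, hk, rfl⟩ : x ∈ {t | ∀ x, ‖F (x + t) - F x‖ < min ε (c x₀)} + K :=
    hTK ▸ Set.mem_univ x
  obtain ⟨v, hv, htv⟩ := key t ht
  exact ⟨t - v, htv, v + k, ⟨v, hVK' v hv, k, hk, rfl⟩, by simp only; abel⟩

end AlmostPeriods

/-! ### The completion as internal group. -/

section InternalGroup

variable {G : Type u} [AddCommGroup G]

/-- A copy of an Abelian group that carries the topology of a seminorm. -/
def WithSeminorm (_ : AddGroupSeminorm G) : Type u := G

noncomputable instance (N : AddGroupSeminorm G) : SeminormedAddCommGroup (WithSeminorm N) :=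
  AddGroupSeminorm.toSeminormedAddCommGroup (E := G) N

/-- The completion of an Abelian group in the topology of a seminorm. -/
abbrev InternalGroup (N : AddGroupSeminorm G) : Type u := UniformSpace.Completion (WithSeminorm N)

/-- The canonical map of a group into its completion. -/
noncomputable def starMap (N : AddGroupSeminorm G) : G →+ InternalGroup N :=
  (UniformSpace.Completion.toCompl : WithSeminorm N →+ InternalGroup N)

theorem norm_starMap (N : AddGroupSeminorm G) (x : G) : ‖starMap N x‖ = N x :=
  UniformSpace.Completion.norm_coe (E := WithSeminorm N) x

theorem denseRange_starMap (N : AddGroupSeminorm G) : DenseRange (starMap N) :=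
  UniformSpace.Completion.denseRange_coe (α := WithSeminorm N)

/-- A function that is uniformly continuous for the seminorm extends to the completion. -/
theorem exists_continuous_extension (N : AddGroupSeminorm G) {f : G → ℝ}
    (hf : ∀ ε > 0, ∃ δ > 0, ∀ t, N t < δ → ∀ x, |f (t + x) - f x| < ε) :
    ∃ φ : InternalGroup N → ℝ, Continuous φ ∧ ∀ x, φ (starMap N x) = f x := by
  let g : WithSeminorm N → ℝ := f
  have hu : UniformContinuous g := by
    refine Metric.uniformContinuous_iff.2 fun ε hε => ?_
    obtain ⟨δ, hδ, h⟩ := hf ε hε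
    refine ⟨δ, hδ, fun {a b} hab => ?_⟩
    rw [dist_eq_norm] at hab
    have h1 : |g (a - b + b) - g b| < ε := h (a - b : WithSeminorm N) hab b
    rwa [sub_add_cancel] at h1
  exact ⟨UniformSpace.Completion.extension g, UniformSpace.Completion.continuous_extension,
    fun x => UniformSpace.Completion.extension_coe hu x⟩

/-- A continuous function on the completion that vanishes off a subset of the group vanishes off the
closure of the subset. -/
theorem eq_zero_of_notMem_closure (N : AddGroupSeminorm G) {φ : InternalGroup N → ℝ}
    (hφ : Continuous φ) {T : Set G} (hT : ∀ x, x ∉ T → φ (starMap N x) = 0) {y : InternalGroup N}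
    (hy : y ∉ closure (starMap N '' T)) : φ y = 0 := by
  have h1 := (denseRange_starMap N).open_subset_closure_inter
    (isClosed_closure (s := starMap N '' T)).isOpen_compl hy
  refine closure_minimal ?_ (isClosed_eq hφ continuous_const) h1
  rintro _ ⟨h, x, rfl⟩
  exact hT x fun hx => h (subset_closure ⟨x, hx, rfl⟩)

theorem ball_subset_closure_starMap_image (N : AddGroupSeminorm G) (ε : ℝ) :
    Metric.ball 0 ε ⊆ closure (starMap N '' {t | N t < ε}) := by
  refine ((denseRange_starMap N).open_subset_closure_inter Metric.isOpen_ball).trans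
    (closure_mono ?_)
  rintro _ ⟨h, x, rfl⟩
  rw [mem_ball_zero_iff, norm_starMap] at h
  exact ⟨x, h, rfl⟩

variable [TopologicalSpace G]

/-- A seminorm ball of radius `min δ ε` is relatively dense and has locally finite differences with
`T`, so finitely many of its translates cover `T`; their images have radius at most `δ`. -/
theorem totallyBounded_starMap_image (N : AddGroupSeminorm G)
    (hd : ∀ ε > 0, RelativelyDense {t | N t < ε}) {T : Set G} {ε : ℝ} (hε : 0 < ε)
    (hT : LocFinite (T - {t | N t < ε})) : TotallyBounded (starMap N '' T) := by
  rw [Metric.totallyBounded_iff]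
  intro δ hδ
  obtain ⟨F, hF, -, hTF⟩ := exists_finite_subset_add (hd (min δ ε) (lt_min hδ hε))
    (hT.mono (Set.sub_subset_sub_left fun t (ht : N t < _) =>
      show N t < ε from ht.trans_le (min_le_right _ _)))
  refine ⟨starMap N '' F, hF.image _, ?_⟩
  rintro _ ⟨x, hx, rfl⟩
  obtain ⟨t, ht, k, hk, rfl⟩ := hTF hx
  refine Set.mem_biUnion ⟨k, hk, rfl⟩ ?_
  rw [Metric.mem_ball, dist_eq_norm, ← map_sub, norm_starMap]
  simpa using lt_of_lt_of_le ht (min_le_left _ _)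

/-- Differences of the ball of radius `ε / 2` stay in the locally finite ball of radius `ε`, so its
image is totally bounded and has compact closure in the complete group. -/
theorem exists_isCompact_ball_subset (N : AddGroupSeminorm G)
    (hd : ∀ ε > 0, RelativelyDense {t | N t < ε}) {ε : ℝ} (hε : 0 < ε)
    (hf : LocFinite {t | N t < ε}) :
    ∃ C : Set (InternalGroup N), IsCompact C ∧ Metric.ball 0 (ε / 2) ⊆ C := by
  refine ⟨_, (totallyBounded_starMap_image N hd (half_pos hε)
    (hf.mono ?_)).closure.isCompact_of_isClosed isClosed_closure,
    ball_subset_closure_starMap_image N (ε / 2)⟩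
  rintro _ ⟨a, ha, b, hb, rfl⟩
  have := map_sub_le_add N a b
  simp only [Set.mem_ofPred_eq] at ha hb ⊢
  linarith

theorem locallyCompactSpace_internalGroup (N : AddGroupSeminorm G)
    (hd : ∀ ε > 0, RelativelyDense {t | N t < ε}) {ε : ℝ} (hε : 0 < ε)
    (hf : LocFinite {t | N t < ε}) : LocallyCompactSpace (InternalGroup N) := by
  obtain ⟨C, hC, hsub⟩ := exists_isCompact_ball_subset N hd hε hf
  exact hC.locallyCompactSpace_of_mem_nhds_of_addGroup
    (mem_of_superset (Metric.ball_mem_nhds 0 (half_pos hε)) hsub)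

variable [IsTopologicalAddGroup G]

/-- Discreteness: an element of the graph near `0` in both coordinates lies in the locally finite
ball near `0`, hence is `0`. Cocompactness: approximate `h` by `x⋆` within `ε / 4`, then adjust `x`
by an `ε / 4`-period `p` to bring the first coordinate within a compact set; the second coordinate
is still off by less than `ε / 2`. -/
theorem isLattice_range_starMap [T2Space G] [LocallyCompactSpace G] (N : AddGroupSeminorm G)
    (hd : ∀ ε > 0, RelativelyDense {t | N t < ε}) {ε : ℝ} (hε : 0 < ε)
    (hf : LocFinite {t | N t < ε}) : IsLattice ((AddMonoidHom.id G).prod (starMap N)).range := by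
  constructor
  · refine discreteTopology_of_isOpen_singleton_zero ?_
    obtain ⟨U, hU, hUo, hU0⟩ := eventually_nhds_iff.1 (hf.eventually_eq 0)
    rw [isOpen_induced_iff]
    refine ⟨U ×ˢ Metric.ball 0 ε, hUo.prod Metric.isOpen_ball, ?_⟩
    ext ⟨_, x, rfl⟩
    simp only [Set.mem_preimage, Set.mem_prod, AddMonoidHom.prod_apply, AddMonoidHom.id_apply,
      mem_ball_zero_iff, norm_starMap, Set.mem_singleton_iff]
    constructor
    · rintro ⟨h1, h2⟩
      have : x = 0 := hU x h1 h2
      exact Subtype.ext (by simp [this])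
    · intro h
      have : x = 0 := congrArg (fun z : ((AddMonoidHom.id G).prod (starMap N)).range =>
        (z : G × InternalGroup N).1) h
      subst this
      exact ⟨hU0, by simpa using hε⟩
  · obtain ⟨C, hC, hsub⟩ := exists_isCompact_ball_subset N hd hε hf
    obtain ⟨K, hK, hPK⟩ := hd (ε / 4) (by positivity)
    refine ⟨K ×ˢ C, hK.prod hC, Set.eq_univ_of_forall fun ⟨a, h⟩ => ?_⟩
    obtain ⟨x, hx⟩ := (denseRange_starMap N).exists_dist_lt h (show 0 < ε / 4 by positivity)
    obtain ⟨p, hp, k, hk, e⟩ : a - x ∈ {t | N t < ε / 4} + K := hPK ▸ Set.mem_univ _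
    refine ⟨(x + p, starMap N (x + p)), ⟨x + p, rfl⟩, (k, h - starMap N (x + p)),
      ⟨hk, hsub ?_⟩, ?_⟩
    · rw [mem_ball_zero_iff, map_add, ← sub_sub]
      refine (norm_sub_le _ _).trans_lt ?_
      rw [norm_starMap, ← dist_eq_norm]
      simp only [Set.mem_ofPred_eq] at hp
      linarith
    · simp only at e
      have : x + p + k = a := by rw [add_assoc, e]; abel
      simp [this]

/-- The cut and project scheme of a seminorm whose small balls are locally finite and relatively
dense. -/
noncomputable def seminormScheme [T2Space G] [LocallyCompactSpace G] (N : AddGroupSeminorm G)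
    (hd : ∀ ε > 0, RelativelyDense {t | N t < ε}) {ε : ℝ} (hε : 0 < ε)
    (hf : LocFinite {t | N t < ε}) : CutProjectScheme G (InternalGroup N) where
  lattice := ((AddMonoidHom.id G).prod (starMap N)).range
  isLattice := isLattice_range_starMap N hd hε hf
  injOn_fst := by
    rintro _ ⟨x, rfl⟩ _ ⟨y, rfl⟩ h
    have : x = y := h
    rw [this]
  dense_snd := (denseRange_starMap N).mono (by
    rintro _ ⟨x, rfl⟩
    exact ⟨(x, starMap N x), ⟨x, rfl⟩, rfl⟩)

end InternalGroup

/-! ### The translation seminorm. -/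

section PointMass

variable {G : Type*}

theorem apply_sub_le_one {c : G → ℝ} (hc0 : ∀ x, 0 ≤ c x) (hc1 : ∀ x, c x ≤ 1) (a b : G) :
    |c a - c b| ≤ 1 :=
  abs_le.2 ⟨by linarith [hc0 a, hc1 b], by linarith [hc0 b, hc1 a]⟩

variable [AddCommGroup G]

/-- The sup norm distance of a bounded function from its translates, as a seminorm. -/
noncomputable def translationSeminorm (c : G → ℝ) (hc0 : ∀ x, 0 ≤ c x) (hc1 : ∀ x, c x ≤ 1) :
    AddGroupSeminorm G where
  toFun t := ⨆ x, |c (t + x) - c x|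
  map_zero' := by simp
  add_le' s t := by
    have hb : ∀ t, BddAbove (Set.range fun x => |c (t + x) - c x|) := fun t =>
      ⟨1, by rintro _ ⟨x, rfl⟩; exact apply_sub_le_one hc0 hc1 _ _⟩
    refine ciSup_le fun x => ?_
    have h1 := le_ciSup (hb s) (t + x)
    have h2 := le_ciSup (hb t) x
    rw [add_assoc]
    exact (abs_sub_le _ _ _).trans (add_le_add h1 h2)
  neg' t := by
    rw [← (Equiv.addLeft t).iSup_comp (g := fun x => |c (-t + x) - c x|)]
    simp [abs_sub_comm]

theorem abs_sub_le_translationSeminorm {c : G → ℝ} (hc0 : ∀ x, 0 ≤ c x) (hc1 : ∀ x, c x ≤ 1)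
    (t x : G) : |c (t + x) - c x| ≤ translationSeminorm c hc0 hc1 t :=
  le_ciSup (f := fun x => |c (t + x) - c x|)
    ⟨1, by rintro _ ⟨x, rfl⟩; exact apply_sub_le_one hc0 hc1 _ _⟩ x

theorem translationSeminorm_le {c : G → ℝ} (hc0 : ∀ x, 0 ≤ c x) (hc1 : ∀ x, c x ≤ 1)
    {t : G} {ε : ℝ} (h : ∀ x, |c (t + x) - c x| ≤ ε) : translationSeminorm c hc0 hc1 t ≤ ε :=
  ciSup_le h

theorem diracComb_singleton {X : Type*} [MeasurableSpace X] [MeasurableSingletonClass X]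
    (Λ : Set X) (x : X) : diracComb Λ {x} = Λ.indicator 1 x := by
  rw [diracComb_apply Λ (measurableSet_singleton x), tsum_eq_single x]
  · by_cases h : x ∈ Λ <;> simp [h]
  · intro y hy
    by_cases h : y ∈ Λ <;> simp [h, hy]

end PointMass

/-! ### From sandwiching combs to a window. -/

/-- A Dirac comb that is sandwiched between strongly almost periodic measures with Meyer supports
and small difference of means is the comb of a regular inter model set. -/
theorem isRegularInterModelSetMetrisable_of_sandwich {G : Type u} [AddCommGroup G]
    [TopologicalSpace G] [IsTopologicalAddGroup G] [T2Space G] [LocallyCompactSpace G]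
    [SigmaCompactSpace G] [MeasurableSpace G] [BorelSpace G] {θ : Measure G} [θ.IsAddHaarMeasure]
    {Λ : Set G} {ω ν : ℕ → Measure G} (hωr : ∀ n, (ω n).Regular) (hνr : ∀ n, (ν n).Regular)
    (hν : Antitone ν) (hωΛ : ∀ n, ω n ≤ diracComb Λ) (hΛν : ∀ n, diracComb Λ ≤ ν n)
    (hωap : IsStronglyAlmostPeriodic (ω 0)) (hωM : ∀ n, IsMeyer (ω n).support)
    (hνM : ∀ n, IsMeyer (ν n).support) {m : ℕ → ℝ} (hm : ∀ n, HasMeanSub θ (ν n) (ω n) (m n))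
    (hm0 : Tendsto m atTop (𝓝 0)) (hνu : ∀ n, UniformlyContinuousIn (ν n) (ω 0))
    (hωu : ∀ n, UniformlyContinuousIn (ω n) (ω 0)) : IsRegularInterModelSetMetrisable Λ := by
  have hωfin : ∀ n x, ω n {x} ≠ ∞ := fun n x => isCompact_singleton.measure_lt_top.ne
  have hνfin : ∀ n x, ν n {x} ≠ ∞ := fun n x => isCompact_singleton.measure_lt_top.ne
  have hω1 : ∀ n x, (ω n).real {x} ≤ 1 := fun n x => by
    refine ENNReal.toReal_le_of_le_ofReal zero_le_one ((hωΛ n {x}).trans ?_)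
    rw [diracComb_singleton, ENNReal.ofReal_one]
    exact Set.indicator_le_self' (fun _ _ => zero_le_one) x
  have hωmem : ∀ n x, (ω n).real {x} ≠ 0 → x ∈ Λ := fun n x hx => by
    by_contra h
    have h1 := hωΛ n {x}
    rw [diracComb_singleton, Set.indicator_of_notMem h] at h1
    exact hx (by rw [measureReal_def, le_antisymm h1 zero_le, ENNReal.toReal_zero])
  have hν1 : ∀ n, ∀ x ∈ Λ, 1 ≤ (ν n).real {x} := fun n x hx => by
    have h1 := hΛν n {x}
    rw [diracComb_singleton, Set.indicator_of_mem hx] at h1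
    simpa [measureReal_def] using ENNReal.toReal_mono (hνfin n x) h1
  have hων : ∀ n k x, (ω n).real {x} ≤ (ν k).real {x} := fun n k x =>
    ENNReal.toReal_mono (hνfin k x) ((hωΛ n).trans (hΛν k) {x})
  set S := (ω 0).support with hS
  set S₀ := (ν 0).support with hS₀
  have hSS₀ : S ⊆ S₀ := Measure.support_mono ((hωΛ 0).trans (hΛν 0))
  set N := translationSeminorm (fun x => (ω 0).real {x}) (fun _ => measureReal_nonneg) (hω1 0)
    with hN
  have hd : ∀ ε > 0, RelativelyDense {t | N t < ε} := fun ε hε =>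
    (relativelyDense_almostPeriods hωap (hωM 0) (half_pos hε)).mono fun t ht =>
      show N t < ε from (translationSeminorm_le _ (hω1 0) fun z => ht z).trans_lt (half_lt_self hε)
  obtain ⟨x₀, hx₀⟩ := (hωM 0).1.nonempty
  have hε₀ : 0 < (ω 0).real {x₀} := measureReal_singleton_pos (hωM 0).locFinite hx₀
  set ε₀ := (ω 0).real {x₀} with hε₀def
  -- A shift with tolerance below the mass at `x₀` must carry `x₀` to a charged point.
  have hPS : {t | N t < ε₀} ⊆ S - S := by
    intro t ht
    have h1 := (abs_sub_le_translationSeminorm (fun _ => measureReal_nonneg) (hω1 0) t x₀).trans_lt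
      (show N t < ε₀ from ht)
    refine ⟨t + x₀, mem_support_of_measureReal_singleton_ne_zero fun h0 => ?_, x₀, hx₀, by simp⟩
    rw [h0, zero_sub, abs_neg, abs_of_pos hε₀] at h1
    exact lt_irrefl _ h1
  have hf : LocFinite {t | N t < ε₀} := (hωM 0).locFinite_sub.mono hPS
  have hf₀ : LocFinite (S₀ - {t | N t < ε₀}) := by
    refine (hνM 0).2.neg.mono ?_
    rintro _ ⟨a, ha, p, hp, rfl⟩
    obtain ⟨s, hs, s', hs', rfl⟩ := hPS hp
    rw [Set.mem_neg]
    exact ⟨s - s', ⟨s, hSS₀ hs, s', hSS₀ hs', rfl⟩, a, ha, by simp⟩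
  have hlc : LocallyCompactSpace (InternalGroup N) :=
    locallyCompactSpace_internalGroup N hd hε₀ hf
  set C := seminormScheme N hd hε₀ hf with hC
  have hmemC : ∀ x, (x, starMap N x) ∈ C.lattice := fun x => ⟨x, rfl⟩
  have hC' : ∀ x y, (x, y) ∈ C.lattice → y = starMap N x := fun x y hxy =>
    C.snd_unique hxy (hmemC x)
  -- The relation `≼` is uniform continuity of the point masses for `N`, hence extendability to the
  -- completion.
  have hext : ∀ ρ : Measure G, UniformlyContinuousIn ρ (ω 0) →
      ∃ φ : InternalGroup N → ℝ, Continuous φ ∧ ∀ x, φ (starMap N x) = ρ.real {x} := by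
    intro ρ hρ
    refine exists_continuous_extension N (f := fun x => ρ.real {x}) fun ε hε => ?_
    obtain ⟨δ, hδ, hsub⟩ := hρ ε hε
    refine ⟨δ, hδ, fun t ht x => ?_⟩
    have h1 : t ∈ supAlmostPeriods ρ ε := hsub (lt_of_le_of_lt (iSup_le fun y =>
      ENNReal.ofReal_le_ofReal (abs_sub_le_translationSeminorm (fun _ => measureReal_nonneg)
        (hω1 0) t y)) ((ENNReal.ofReal_lt_ofReal_iff hδ).2 ht))
    rw [← ENNReal.ofReal_lt_ofReal_iff hε]
    exact (le_iSup (fun x => ENNReal.ofReal |ρ.real {t + x} - ρ.real {x}|) x).trans_lt h1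
  choose φ hφ hφx using fun n => hext (ν n) (hνu n)
  choose ψ hψ hψx using fun n => hext (ω n) (hωu n)
  have hdense := denseRange_starMap N
  set Kc := closure (starMap N '' S₀) with hKc
  have hKcc : IsCompact Kc :=
    (totallyBounded_starMap_image N hd hε₀ hf₀).closure.isCompact_of_isClosed isClosed_closure
  have hνS₀ : ∀ n, ∀ x, x ∉ S₀ → (ν n).real {x} = 0 := fun n x hx => by
    by_contra h
    exact hx (Measure.support_mono (hν (Nat.zero_le n))
      (mem_support_of_measureReal_singleton_ne_zero h))
  have hφK : ∀ n y, y ∉ Kc → φ n y = 0 := fun n y hy =>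
    eq_zero_of_notMem_closure N (hφ n) (fun x hx => by rw [hφx, hνS₀ n x hx]) hy
  have hψφ : ∀ n k y, ψ n y ≤ φ k y := fun n k y => by
    refine hdense.induction_on y (isClosed_le (hψ n) (hφ k)) fun x => ?_
    rw [hψx, hφx]
    exact hων n k x
  have hψ0 : ∀ n y, 0 ≤ ψ n y := fun n y => by
    refine hdense.induction_on y (isClosed_le continuous_const (hψ n)) fun x => ?_
    rw [hψx]
    exact measureReal_nonneg
  have hφc : ∀ n, HasCompactSupport (φ n) := fun n => HasCompactSupport.intro hKcc (hφK n)
  have hψc : ∀ n, HasCompactSupport (ψ n) := fun n => HasCompactSupport.intro hKcc fun y hy =>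
    le_antisymm ((hψφ n n y).trans_eq (hφK n y hy)) (hψ0 n y)
  borelize (InternalGroup N)
  set μ : Measure (InternalGroup N) := Measure.addHaar with hμ
  -- All the given measures are weighted combs of the constructed scheme, so one van Hove sequence
  -- determines their means as integrals.
  have hmean : ∃ d : ℝ, 0 < d ∧ ∀ n, m n = d * ∫ y, (φ n y - ψ n y) ∂μ := by
    obtain ⟨d, hd0, hdens⟩ := exists_density θ C μ
    obtain ⟨A, hA⟩ := exists_isVanHove θ
    have hcomb : ∀ (ρ : Measure G) (χ : InternalGroup N → ℝ), ρ.Regular → IsMeyer ρ.support →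
        (∀ x, χ (starMap N x) = ρ.real {x}) → IsWeightedModelComb C χ ρ := fun ρ χ _ hρM hρ =>
      ⟨inferInstance, ⟨_, hρM.locFinite, measure_compl_support_eq_zero ρ⟩,
        fun x y hxy => by rw [hC' x y hxy, hρ], fun x hx => absurd (hmemC x) (hx _)⟩
    refine ⟨d, hd0, fun n => ?_⟩
    have h1 := hdens _ (hφ n) (hφc n) _ (hcomb _ _ (hνr n) (hνM n) (hφx n)) A hA
    have h2 := hdens _ (hψ n) (hψc n) _ (hcomb _ _ (hωr n) (hωM n) (hψx n)) A hA
    have h3 := hm n A hA 0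
    simp only [zero_vadd, sub_div] at h3
    rw [tendsto_nhds_unique h3 (h1.sub h2), integral_sub
      ((hφ n).integrable_of_hasCompactSupport (hφc n))
      ((hψ n).integrable_of_hasCompactSupport (hψc n)), mul_sub]
  set U : Set (InternalGroup N) := ⋃ n, {y | 0 < ψ n y} with hUdef
  set K : Set (InternalGroup N) := ⋂ n, {y | 1 ≤ φ n y} with hKdef
  have hUo : IsOpen U := isOpen_iUnion fun n => isOpen_lt continuous_const (hψ n)
  have hKcl : IsClosed K := isClosed_iInter fun n => isClosed_le continuous_const (hφ n)
  have hKc' : IsCompact K := hKcc.of_isClosed_subset hKcl fun y hy => by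
    by_contra h
    have h1 : 1 ≤ φ 0 y := Set.mem_iInter.1 hy 0
    rw [hφK 0 y h] at h1
    exact absurd h1 (by norm_num)
  have hΛK : ∀ x ∈ Λ, starMap N x ∈ K := fun x hx => Set.mem_iInter.2 fun n => by
    rw [Set.mem_ofPred_eq, hφx]
    exact hν1 n x hx
  have hUK : U ⊆ K := by
    -- A point `x⋆` of `U` comes from some `x` charged by an `ω n`; thus `x` lies in `Λ` and `x⋆` in
    -- the closed set `K`.
    refine (hdense.open_subset_closure_inter hUo).trans (closure_minimal ?_ hKcl)
    rintro _ ⟨hy, x, rfl⟩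
    obtain ⟨n, hn⟩ := Set.mem_iUnion.1 hy
    rw [Set.mem_ofPred_eq, hψx] at hn
    exact hΛK x (hωmem n x hn.ne')
  have hnull : μ (K \ U) = 0 := by
    obtain ⟨d, hd0, hmd⟩ := hmean
    have hmeas : MeasurableSet (K \ U) := hKcl.measurableSet.diff hUo.measurableSet
    have hle : ∀ n, μ.real (K \ U) ≤ m n / d := fun n => by
      rw [hmd n, mul_div_cancel_left₀ _ hd0.ne', ← integral_indicator_one hmeas]
      refine integral_mono_of_nonneg (ae_of_all _ fun y => Set.indicator_nonneg (by simp) y)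
        (((hφ n).integrable_of_hasCompactSupport (hφc n)).sub
          ((hψ n).integrable_of_hasCompactSupport (hψc n))) (ae_of_all _ fun y => ?_)
      by_cases hy : y ∈ K \ U
      · have h1 : 1 ≤ φ n y := Set.mem_iInter.1 hy.1 n
        have h2 : ψ n y ≤ 0 := not_lt.1 fun h => hy.2 (Set.mem_iUnion.2 ⟨n, h⟩)
        simp only [Set.indicator_of_mem hy, Pi.one_apply]
        linarith
      · simp only [Set.indicator_of_notMem hy]
        linarith [hψφ n n y]
    have h0 : μ.real (K \ U) ≤ 0 := by
      refine ge_of_tendsto' (x := atTop) (f := fun n => m n / d) ?_ hle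
      simpa using hm0.div_const d
    exact (measureReal_eq_zero_iff
      (measure_mono Set.sdiff_subset |>.trans_lt hKc'.measure_lt_top).ne).1
      (le_antisymm h0 measureReal_nonneg)
  -- The closure of `U` may miss some `x⋆` with `x` in `Λ`, so these points are added. They lie in
  -- the null set `K \ U` and off the closure of `U`, hence contribute nothing to the interior, as
  -- non-empty open sets have positive measure.
  set W : Set (InternalGroup N) := U ∪ (starMap N '' Λ \ closure U) with hW
  have hWK : W ⊆ K := Set.union_subset hUK (Set.sdiff_subset.trans (by
    rintro _ ⟨x, hx, rfl⟩
    exact hΛK x hx))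
  have hWcl : closure W ⊆ K := closure_minimal hWK hKcl
  have hUW : U ⊆ interior W := interior_maximal Set.subset_union_left hUo
  have hWU : interior W ⊆ U := by
    intro y hy
    rcases interior_subset hy with h | h
    · exact h
    · exfalso
      have hopen : IsOpen (interior W \ closure U) := isOpen_interior.sdiff isClosed_closure
      refine (hopen.measure_pos μ ⟨y, hy, h.2⟩).ne' (measure_mono_null ?_ hnull)
      exact fun z hz => ⟨hWK (interior_subset hz.1), fun hzU => hz.2 (subset_closure hzU)⟩
  refine ⟨InternalGroup N, inferInstance, inferInstance, inferInstance, hlc, inferInstance,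
    inferInstance, inferInstance, C, W, hKc'.of_isClosed_subset isClosed_closure hWcl,
    ⟨starMap N x₀, hUW (Set.mem_iUnion.2 ⟨0, ?_⟩)⟩,
    measure_mono_null (t := K \ U) (fun y hy => ⟨hWcl hy.1, fun hyU => hy.2 (hUW hyU)⟩) hnull,
    ?_, ?_⟩
  · rw [Set.mem_ofPred_eq, hψx]
    exact hε₀
  · rintro x ⟨y, hy, hxy⟩
    rw [hC' x y hxy] at hy
    obtain ⟨n, hn⟩ := Set.mem_iUnion.1 (hWU hy)
    rw [Set.mem_ofPred_eq, hψx] at hn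
    exact hωmem n x hn.ne'
  · intro x hx
    refine ⟨starMap N x, ?_, hmemC x⟩
    by_cases h : starMap N x ∈ closure U
    · exact closure_mono Set.subset_union_left h
    · exact subset_closure (Or.inr ⟨⟨x, hx, rfl⟩, h⟩)

end MeyerComb

theorem mainTheorem11 {G : Type u} [AddCommGroup G] [TopologicalSpace G]
    [IsTopologicalAddGroup G] [T2Space G] [LocallyCompactSpace G] [SigmaCompactSpace G]
    [MeasurableSpace G] [BorelSpace G]
    (θ : Measure G) [θ.IsAddHaarMeasure] [θ.Regular]
    (Λ : Set G) (hΛ : MeyerComb.IsDelone Λ) :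
    MeyerComb.IsRegularInterModelSetMetrisable Λ ↔
      ∃ ω ν : ℕ → Measure G,
        (∀ n, (ω n).Regular) ∧ (∀ n, (ν n).Regular) ∧
        Monotone ω ∧ Antitone ν ∧
        (∀ n, ω n ≤ MeyerComb.diracComb Λ) ∧ (∀ n, MeyerComb.diracComb Λ ≤ ν n) ∧
        (∀ n, MeyerComb.IsStronglyAlmostPeriodic (ω n) ∧ MeyerComb.IsMeyer (ω n).support) ∧
        (∀ n, MeyerComb.IsStronglyAlmostPeriodic (ν n) ∧ MeyerComb.IsMeyer (ν n).support) ∧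
        (∃ m : ℕ → ℝ, (∀ n, MeyerComb.HasMeanSub θ (ν n) (ω n) (m n)) ∧
          Tendsto m atTop (𝓝 0)) ∧
        (∀ n, MeyerComb.UniformlyContinuousIn (ν n) (ω 0)) ∧
        (∀ n, MeyerComb.UniformlyContinuousIn (ω n) (ω 0)) := by
  refine ⟨fun h => h.exists_sandwich θ, ?_⟩
  rintro ⟨ω, ν, hωr, hνr, -, hν, hωΛ, hΛν, hω, hνM, ⟨m, hm, hm0⟩, hνu, hωu⟩
  exact MeyerComb.isRegularInterModelSetMetrisable_of_sandwich hωr hνr hν hωΛ hΛν (hω 0).1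
    (fun n => (hω n).2) (fun n => (hνM n).2) hm hm0 hνu hωu
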